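/- For a finite set $A\subset\mathbb Z^3$ let $\mathrm{Cap}(A)=\sum_{x\in A}P^x(\tau_A=\infty)$, where $P^x$ is the law of simple random walk $(S_n)_{n\ge 0}$ on $\mathbb Z^3$ started at $x$ and $\tau_A=\inf\{n\ge 1: S_n\in A\}$. For real $m\ge 1$, an integer $\ell\ge 1$ and $r>0$ let $$\mathcal C_m(\ell,r)=(\ell\mathbb Z)^3\cap\{(x_1,x_2,x_3): x_1^2+x_2^2\le r^2,\ 1\le x_3\le m\},$$ and let $\mathbb B(z,r)=\{x\in\mathbb Z^3:|x-z|\le r\}$, with $|\cdot|$ the Euclidean norm. Let $(r_m)$ be real numbers, indexed by real $m\ge 1$, with $r_m\to\infty$ and $r_m=o(m)$ as $m\to\infty$. (a) Fix $b<2/3$, and let $\mathcal C_m\subset\mathbb Z^3$ be sets such that for all large $m$ there is an integer $1\le\ell\le r_m^b$, which may depend on $m$, with $\mathcal C_m(\ell,r_m)\subseteq\mathcal C_m\subseteq\mathcal C_m(1,r_m)$. Then $$\lim_{m\to\infty}\frac{\mathrm{Cap}(\mathcal C_m)}{m\,(\log(m/r_m))^{-1}}=\frac{\pi}{3}.$$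 (b) Let $\mathcal C_m\subset\mathbb Z^3$ be sets such that for all large $m$, $\mathcal C_m\subseteq\bigcup_{i=1}^{N}\mathbb B(z_i,r_m)$ for some integer $0\le N\le m/r_m$ and some $z_1,\dots,z_N\in\mathbb Z^3$ with $|z_{i+1}-z_i|\le r_m$ for $1\le i<N$ ($N$ and the $z_i$ may depend on $m$). Then $$\limsup_{m\to\infty}\frac{\mathrm{Cap}(\mathcal C_m)}{m\,(\log(m/r_m))^{-1}}\le\frac{\pi}{3}.$$ -/

import Mathlib

open Filter Topology Asymptotics MeasureTheory

noncomputable section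

namespace SRW3

/-- The lattice `ℤ³`. -/
abbrev Lattice : Type := Fin 3 → ℤ

/-- The Euclidean norm `|x|` of a lattice point. -/
def euclNorm (x : Lattice) : ℝ := √(∑ i, (x i : ℝ) ^ 2)

/-- The (closed, Euclidean) lattice ball `𝔹(z, r)`. -/
def ball (z : Lattice) (r : ℝ) : Set Lattice := {x | euclNorm (x - z) ≤ r}

/-- The sparse lattice cylinder
`𝒞_m(ℓ, r) = (ℓℤ)³ ∩ {x : x₁² + x₂² ≤ r², 1 ≤ x₃ ≤ m}`. -/
def cylinder (m : ℝ) (l : ℕ) (r : ℝ) : Set Lattice :=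
  {x | (∀ i, (l : ℤ) ∣ x i) ∧ (x 0 : ℝ) ^ 2 + (x 1 : ℝ) ^ 2 ≤ r ^ 2 ∧
    1 ≤ x 2 ∧ (x 2 : ℝ) ≤ m}

/-- A direction of a nearest neighbour step: a coordinate and a sign. -/
abbrev Dir : Type := Fin 3 × Bool

/-- The step `± e_i`; the six directions give the six neighbours of the origin. -/
def step (e : Dir) : Lattice := Pi.single e.1 (if e.2 then 1 else -1)

/-- The law of an i.i.d. sequence of uniformly chosen directions. -/
def law : Measure (ℕ → Dir) :=
  Measure.infinitePi fun _ : ℕ => (PMF.uniformOfFintype Dir).toMeasure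

instance : IsProbabilityMeasure law := by
  unfold law; infer_instance

/-- Simple random walk `S_n` started at `x`. -/
def walk (x : Lattice) (ω : ℕ → Dir) (n : ℕ) : Lattice :=
  x + ∑ i ∈ Finset.range n, step (ω i)

/-- `P^x(τ_A = ∞)`, where `τ_A = inf {n ≥ 1 : S_n ∈ A}` is the first positive hitting time. -/
def escapeProb (A : Finset Lattice) (x : Lattice) : ℝ :=
  law.real {ω | ∀ n, 1 ≤ n → walk x ω n ∉ A}

/-- The capacity `Cap(A) = ∑_{x ∈ A} P^x(τ_A = ∞)` of a finite set `A ⊂ ℤ³`. -/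
def cap (A : Finset Lattice) : ℝ := ∑ x ∈ A, escapeProb A x

end SRW3

end

/-! The escape probabilities from a finite set `A` form its equilibrium measure. Decomposing a path
at its last visit to `A` shows that the Green potential of this measure is the probability that a
last visit exists: at most 1 everywhere and, by transience, equal to 1 on `A`. Since `green` is
symmetric, pairing with a test measure gives bounds in both directions. Points of weight `c` whose
potential is at least 1 on `A` bound the capacity above by their total mass
(`cap_le_of_one_le_potential`). A subset `B` whose counting measure has potential at most `U` on `B`
bounds it below by `B.card / U` (`le_cap_of_potential_le`).

The analytic input is G(x) ∼ 3/(2π|x|) (`tendsto_euclNorm_mul_green`). Running the walk at Poisson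
times makes its coordinates independent, so G is the time integral of a product of three
one-dimensional heat kernels. Fourier estimates then justify dominated convergence under diffusive
scaling.

A mass λ per unit length on a line of length m, felt from distance r on, has potential about 2λ ·
3/(2π) · log(m/r). Setting this equal to 1 gives the total mass (π/3) m / log(m/r). For the upper
bound the mass sits at the centres of the chain, slightly prolonged at both ends; bending the chain
only brings points closer and increases the potential (`cap_chain_le`). For the lower bound it is
spread uniformly over a sparse box inside the cylinder; nearby points and the self-interaction are
negligible against the logarithm as long as l³ ≤ r² (`exists_le_cap_of_cylinder_subset`). -/

noncomputable section

namespace SRW3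

/-! ### First-step decomposition and transition probabilities. -/

/-- Prepend a direction to a sequence of directions. -/
def consSeq (p : Dir × (ℕ → Dir)) : ℕ → Dir := fun n => Nat.casesOn n p.1 p.2

lemma measurable_consSeq : Measurable consSeq := by
  refine measurable_pi_lambda _ fun n => ?_
  cases n with
  | zero => exact measurable_fst
  | succ k => exact (measurable_pi_apply k).comp measurable_snd

/-- An infinite product measure is determined by finite-dimensional boxes, and on these coordinate 0
splits off as an independent factor. -/
lemma map_consSeq_law :
    ((PMF.uniformOfFintype Dir).toMeasure.prod law).map consSeq = law := by
  unfold law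
  refine Measure.eq_infinitePi _ fun s t ht => ?_
  rw [Measure.map_apply measurable_consSeq (MeasurableSet.pi s.countable_toSet fun i _ => ht i)]
  set μ : Measure Dir := (PMF.uniformOfFintype Dir).toMeasure
  classical
  set A : Set Dir := if 0 ∈ s then t 0 else Set.univ
  set s' : Finset ℕ := (s.erase 0).image (fun n => n - 1)
  have hpre : consSeq ⁻¹' (Set.pi (s : Set ℕ) t) =
      A ×ˢ Set.pi (s' : Set ℕ) (fun n => t (n + 1)) := by
    ext ⟨d, ω⟩
    simp only [Set.mem_preimage, Set.mem_pi, Finset.mem_coe, Set.mem_prod]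
    constructor
    · intro h
      refine ⟨?_, ?_⟩
      · by_cases h0 : 0 ∈ s
        · simp only [A, if_pos h0]
          exact h 0 h0
        · simp [A, h0]
      · intro i hi
        obtain ⟨n, hn, rfl⟩ := Finset.mem_image.1 hi
        obtain ⟨hn0, hns⟩ := Finset.mem_erase.1 hn
        obtain ⟨k, rfl⟩ := Nat.exists_eq_succ_of_ne_zero hn0
        exact h _ hns
    · rintro ⟨h1, h2⟩ i hi
      cases i with
      | zero =>
        simp only [A, if_pos hi] at h1
        exact h1
      | succ k =>
        exact h2 k (Finset.mem_image.2 ⟨k + 1, Finset.mem_erase.2 ⟨by omega, hi⟩, rfl⟩)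
  rw [hpre, Measure.prod_prod, Measure.infinitePi_pi _ (fun i _ => ht (i + 1))]
  have hprod : ∏ i ∈ s', μ (t (i + 1)) = ∏ i ∈ s.erase 0, μ (t i) := by
    rw [Finset.prod_image]
    · refine Finset.prod_congr rfl fun i hi => ?_
      have := (Finset.mem_erase.1 hi).1
      rw [Nat.sub_add_cancel (by omega)]
    · intro a ha b hb hab
      have h1 := (Finset.mem_erase.1 ha).1
      have h2 := (Finset.mem_erase.1 hb).1
      simp only at hab
      omega
  rw [hprod]
  by_cases h0 : 0 ∈ s
  · rw [← Finset.mul_prod_erase s (fun i => μ (t i)) h0]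
    simp [A, h0]
  · simp [A, h0]

/-- This is the Markov property at time 1, the only form in which it is used; later times follow by
induction. -/
lemma law_real_cons (Q : Dir → Set (ℕ → Dir)) (hQ : ∀ d, MeasurableSet (Q d)) :
    law.real {ω | (fun n => ω (n + 1)) ∈ Q (ω 0)} = (1 / 6) * ∑ d, law.real (Q d) := by
  have hS : MeasurableSet {ω : ℕ → Dir | (fun n => ω (n + 1)) ∈ Q (ω 0)} := by
    have : {ω : ℕ → Dir | (fun n => ω (n + 1)) ∈ Q (ω 0)} =
        ⋃ d, {ω | ω 0 = d} ∩ (fun (ω : ℕ → Dir) n => ω (n + 1)) ⁻¹' Q d := by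
      ext ω; simp
    rw [this]
    refine MeasurableSet.iUnion fun d => MeasurableSet.inter ?_ ?_
    · exact (measurable_pi_apply (X := fun _ : ℕ => Dir) 0) (measurableSet_singleton d)
    · exact (measurable_pi_lambda _ fun n => measurable_pi_apply (n + 1)) (hQ d)
  have hT : MeasurableSet (consSeq ⁻¹' {ω : ℕ → Dir | (fun n => ω (n + 1)) ∈ Q (ω 0)}) :=
    measurable_consSeq hS
  have h1 : law {ω | (fun n => ω (n + 1)) ∈ Q (ω 0)} = ∑ d, law (Q d) * (6 : ENNReal)⁻¹ := by
    conv_lhs => rw [← map_consSeq_law]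
    rw [Measure.map_apply measurable_consSeq hS, Measure.prod_apply hT, lintegral_fintype]
    refine Finset.sum_congr rfl fun d _ => ?_
    congr 1
    rw [PMF.toMeasure_apply_singleton _ _ (measurableSet_singleton d)]
    simp [PMF.uniformOfFintype_apply]
  rw [Measure.real, h1, ENNReal.toReal_sum (fun d _ => by finiteness), Finset.mul_sum]
  refine Finset.sum_congr rfl fun d _ => ?_
  rw [ENNReal.toReal_mul, ENNReal.toReal_inv, Measure.real]
  norm_num
  ring

/-- The `n`-step transition probabilities `P⁰(S_n = x)`. -/
def kern : ℕ → Lattice → ℝ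
  | 0, x => if x = 0 then 1 else 0
  | n + 1, x => (1 / 6) * ∑ e, kern n (x - step e)

lemma kern_nonneg (n : ℕ) (x : Lattice) : 0 ≤ kern n x := by
  induction n generalizing x with
  | zero => unfold kern; split_ifs <;> norm_num
  | succ n ih => unfold kern; exact mul_nonneg (by norm_num) (Finset.sum_nonneg fun e _ => ih _)

lemma step_neg (e : Dir) : step (e.1, !e.2) = -step e := by
  unfold step
  rw [← Pi.single_neg]
  rcases e with ⟨i, b⟩
  cases b <;> simp

lemma kern_neg (n : ℕ) (x : Lattice) : kern n (-x) = kern n x := by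
  induction n generalizing x with
  | zero => simp [kern]
  | succ n ih =>
    unfold kern
    congr 1
    refine Fintype.sum_equiv ((Equiv.refl (Fin 3)).prodCongr Equiv.boolNot) _ _ fun e => ?_
    have h : step (((Equiv.refl (Fin 3)).prodCongr Equiv.boolNot) e) = - step e := by
      rw [← step_neg]; rfl
    rw [h, ← ih]
    congr 1
    abel

lemma walk_zero (x : Lattice) (ω : ℕ → Dir) : walk x ω 0 = x := by simp [walk]

lemma walk_succ (x : Lattice) (ω : ℕ → Dir) (n : ℕ) :
    walk x ω (n + 1) = walk (x + step (ω 0)) (fun k => ω (k + 1)) n := by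
  simp only [walk, Finset.sum_range_succ']
  abel

lemma measurable_walk (x : Lattice) (n : ℕ) : Measurable fun ω => walk x ω n := by
  unfold walk
  refine measurable_const.add (Finset.measurable_sum _ fun i _ => ?_)
  exact (measurable_of_countable step).comp (measurable_pi_apply i)

/-! ### Last-exit decomposition and capacity bounds from potentials. -/

/-- The event that the walk started at `y` is at `x` at time `n`, and avoids `A` afterwards. -/
def lastExit (A : Finset Lattice) (y x : Lattice) (n : ℕ) : Set (ℕ → Dir) :=
  {ω | walk y ω n = x ∧ ∀ k, 1 ≤ k → walk y ω (n + k) ∉ A}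

lemma measurableSet_lastExit (A : Finset Lattice) (y x : Lattice) (n : ℕ) :
    MeasurableSet (lastExit A y x n) := by
  have : lastExit A y x n = (fun ω => walk y ω n) ⁻¹' {x} ∩
      ⋂ (k : ℕ), ⋂ (_ : 1 ≤ k), (fun ω => walk y ω (n + k)) ⁻¹' (A : Set Lattice)ᶜ := by
    ext ω; simp [lastExit]
  rw [this]
  refine (measurable_walk y n (measurableSet_singleton x)).inter
    (MeasurableSet.iInter fun k => MeasurableSet.iInter fun _ => ?_)
  exact measurable_walk y (n + k) A.measurableSet.compl

lemma law_lastExit (A : Finset Lattice) (y x : Lattice) (n : ℕ) :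
    law.real (lastExit A y x n) = kern n (x - y) * escapeProb A x := by
  induction n generalizing y with
  | zero =>
    by_cases h : x = y
    · subst h
      simp [kern, lastExit, escapeProb, walk_zero]
    · have : lastExit A y x 0 = ∅ := by
        ext ω; simp [lastExit, walk_zero, Ne.symm h]
      simp [this, kern, sub_eq_zero, h]
  | succ n ih =>
    have h1 : lastExit A y x (n + 1) =
        {ω | (fun k => ω (k + 1)) ∈ lastExit A (y + step (ω 0)) x n} := by
      ext ω
      simp only [lastExit, Set.mem_ofPred_eq, walk_succ, Nat.add_right_comm n 1]
    rw [h1, law_real_cons (fun d => lastExit A (y + step d) x n)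
      fun d => measurableSet_lastExit _ _ _ _]
    simp_rw [ih]
    rw [← Finset.sum_mul, kern, mul_assoc]
    simp_rw [sub_add_eq_sub_sub]

lemma law_walk_eq (y x : Lattice) (n : ℕ) :
    law.real {ω | walk y ω n = x} = kern n (x - y) := by
  have h := law_lastExit ∅ y x n
  simpa [lastExit, escapeProb] using h

lemma escapeProb_nonneg (A : Finset Lattice) (x : Lattice) : 0 ≤ escapeProb A x :=
  measureReal_nonneg

/-- The Green function `G(x) = ∑ₙ P⁰(S_n = x)`. -/
def green (x : Lattice) : ℝ := ∑' n, kern n x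

lemma green_nonneg (x : Lattice) : 0 ≤ green x := tsum_nonneg fun n => kern_nonneg n x

lemma green_neg (x : Lattice) : green (-x) = green x := by
  unfold green; simp_rw [kern_neg]

lemma green_sub_comm (x y : Lattice) : green (x - y) = green (y - x) := by
  rw [← green_neg, neg_sub]

/-- The time and place of the last visit to `A` are determined by the path, so the events are
disjoint and their probabilities add up to the equilibrium potential. -/
lemma law_iUnion_lastExit (hs : ∀ x, Summable fun n => kern n x) (A : Finset Lattice)
    (y : Lattice) :
    law (⋃ p : ℕ × A, lastExit A y p.2 p.1) =
      ENNReal.ofReal (∑ x ∈ A, green (x - y) * escapeProb A x) := by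
  rw [measure_iUnion]
  · rw [ENNReal.tsum_prod', ENNReal.tsum_comm, tsum_fintype, Finset.univ_eq_attach,
      Finset.sum_attach A (fun x => ∑' n, law (lastExit A y x n)),
      ENNReal.ofReal_sum_of_nonneg (fun x _ => mul_nonneg (green_nonneg _)
        (escapeProb_nonneg _ _))]
    refine Finset.sum_congr rfl fun x _ => ?_
    rw [green, ← tsum_mul_right, ENNReal.ofReal_tsum_of_nonneg
      (fun n => mul_nonneg (kern_nonneg _ _) (escapeProb_nonneg _ _)) ((hs _).mul_right _)]
    refine tsum_congr fun n => ?_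
    rw [← law_lastExit, ofReal_measureReal]
  · rintro ⟨n, x⟩ ⟨m, x'⟩ hne
    rw [Function.onFun, Set.disjoint_left]
    rintro ω ⟨h1, h2⟩ ⟨h3, h4⟩
    apply hne
    simp only at h1 h2 h3 h4
    have hnm : n = m := by
      rcases lt_trichotomy n m with h | h | h
      · exfalso
        apply h2 (m - n) (by omega)
        rw [show n + (m - n) = m by omega, h3]
        exact x'.2
      · exact h
      · exfalso
        apply h4 (n - m) (by omega)
        rw [show m + (n - m) = n by omega, h1]
        exact x.2
    subst hnm
    simp only [Prod.mk.injEq, true_and]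
    exact Subtype.ext (h1.symm.trans h3)
  · exact fun p => measurableSet_lastExit _ _ _ _

lemma sum_green_escape_le_one (hs : ∀ x, Summable fun n => kern n x) (A : Finset Lattice)
    (y : Lattice) : ∑ x ∈ A, green (x - y) * escapeProb A x ≤ 1 := by
  have h : law (⋃ p : ℕ × A, lastExit A y p.2 p.1) ≤ 1 := prob_le_one
  rw [law_iUnion_lastExit hs] at h
  exact ENNReal.ofReal_le_one.1 h

/-- A walk started in `A` visits it at time 0 and, by transience, almost surely only finitely often,
so a last visit exists. -/
lemma sum_green_escape_eq_one (hs : ∀ x, Summable fun n => kern n x) (A : Finset Lattice)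
    {y : Lattice} (hy : y ∈ A) : ∑ x ∈ A, green (x - y) * escapeProb A x = 1 := by
  -- Borel–Cantelli: summability of the transition probabilities makes visits to each site finite in
  -- number.
  have hrec : ∀ x : Lattice, law (limsup (fun n => {ω | walk y ω n = x}) atTop) = 0 := by
    intro x
    refine measure_limsup_atTop_eq_zero ?_
    have : ∀ n, law {ω | walk y ω n = x} = ENNReal.ofReal (kern n (x - y)) := fun n => by
      rw [← law_walk_eq, ofReal_measureReal]
    simp_rw [this]
    rw [← ENNReal.ofReal_tsum_of_nonneg (fun n => kern_nonneg _ _) (hs _)]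
    exact ENNReal.ofReal_ne_top
  have hnull : law (⋃ p : ℕ × A, lastExit A y p.2 p.1)ᶜ = 0 := by
    refine measure_mono_null ?_ ((measure_biUnion_null_iff A.countable_toSet).2 fun x _ => hrec x)
    intro ω hω
    by_contra hcon
    apply hω
    simp only [Set.mem_iUnion, not_exists, mem_limsup_iff_frequently_mem, Set.mem_ofPred_eq,
      Finset.mem_coe] at hcon
    have hfin : {n | walk y ω n ∈ A}.Finite := by
      have h1 : {n | walk y ω n ∈ A} = ⋃ x ∈ (A : Set Lattice), {n | walk y ω n = x} := by
        ext n; simp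
      rw [h1]
      refine Set.Finite.biUnion A.finite_toSet fun x hx => ?_
      by_contra hinf
      exact hcon x hx (Nat.frequently_atTop_iff_infinite.2 hinf)
    have hne : hfin.toFinset.Nonempty := ⟨0, by simp [walk_zero, hy]⟩
    set n := hfin.toFinset.max' hne
    have hn : walk y ω n ∈ A := by
      have := hfin.toFinset.max'_mem hne
      simpa using this
    refine Set.mem_iUnion.2 ⟨(n, ⟨walk y ω n, hn⟩), rfl, fun k hk hmem => ?_⟩
    have := hfin.toFinset.le_max' (n + k) (by simpa using hmem)
    omega
  have h1 : law (⋃ p : ℕ × A, lastExit A y p.2 p.1) = 1 :=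
    (prob_compl_eq_zero_iff (MeasurableSet.iUnion fun p => measurableSet_lastExit _ _ _ _)).1 hnull
  rw [law_iUnion_lastExit hs, ENNReal.ofReal_eq_one] at h1
  exact h1

/-- Integrate the potential against the equilibrium measure of `A` and exchange sums: each `p i`
contributes at most 1. The indexing by `ι` lets points be repeated. -/
lemma cap_le_of_one_le_potential (hs : ∀ x, Summable fun n => kern n x) {ι : Type*}
    (A : Finset Lattice) (I : Finset ι) (p : ι → Lattice) {c : ℝ} (hc : 0 ≤ c)
    (h : ∀ x ∈ A, 1 ≤ c * ∑ i ∈ I, green (x - p i)) : cap A ≤ c * I.card := by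
  calc cap A ≤ ∑ x ∈ A, (c * ∑ i ∈ I, green (x - p i)) * escapeProb A x :=
        Finset.sum_le_sum fun x hx =>
          le_mul_of_one_le_left (escapeProb_nonneg _ _) (h x hx)
    _ = c * ∑ i ∈ I, ∑ x ∈ A, green (x - p i) * escapeProb A x := by
        rw [Finset.sum_comm, Finset.mul_sum]
        refine Finset.sum_congr rfl fun x _ => ?_
        rw [mul_assoc, Finset.sum_mul]
    _ ≤ c * ∑ i ∈ I, 1 := by
        gcongr with i _
        exact sum_green_escape_le_one hs A (p i)
    _ = c * I.card := by simp

lemma le_cap_of_potential_le (hs : ∀ x, Summable fun n => kern n x)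
    {A B : Finset Lattice} (hBA : B ⊆ A) {U : ℝ} (hU : 0 < U)
    (h : ∀ x ∈ B, ∑ y ∈ B, green (y - x) ≤ U) : B.card / U ≤ cap A := by
  -- Pairing the equilibrium measures of `B` and `A` through `green` gives monotonicity: the
  -- potential of `A` is 1 on `B`, that of `B` is at most 1 on `A`.
  have hmono : cap B ≤ cap A := by
    calc cap B = ∑ x ∈ B, escapeProb B x * ∑ y ∈ A, green (y - x) * escapeProb A y := by
          refine Finset.sum_congr rfl fun x hx => ?_
          rw [sum_green_escape_eq_one hs A (hBA hx), mul_one]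
      _ = ∑ y ∈ A, (∑ x ∈ B, green (x - y) * escapeProb B x) * escapeProb A y := by
          simp_rw [Finset.mul_sum, Finset.sum_mul]
          rw [Finset.sum_comm]
          refine Finset.sum_congr rfl fun y _ => Finset.sum_congr rfl fun x _ => ?_
          rw [green_sub_comm x y]; ring
      _ ≤ ∑ y ∈ A, 1 * escapeProb A y := by
          gcongr with y _
          · exact escapeProb_nonneg _ _
          · exact sum_green_escape_le_one hs B y
      _ = cap A := by simp [cap]
  refine le_trans ?_ hmono
  rw [div_le_iff₀ hU]
  calc (B.card : ℝ) = ∑ y ∈ B, ∑ x ∈ B, green (x - y) * escapeProb B x := by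
        rw [Finset.sum_congr rfl fun y hy => sum_green_escape_eq_one hs B hy]
        simp
    _ = ∑ x ∈ B, escapeProb B x * ∑ y ∈ B, green (y - x) := by
        rw [Finset.sum_comm]
        refine Finset.sum_congr rfl fun x _ => ?_
        rw [Finset.mul_sum]
        refine Finset.sum_congr rfl fun y _ => ?_
        rw [green_sub_comm x y]; ring
    _ ≤ ∑ x ∈ B, escapeProb B x * U := by
        gcongr with x hx
        · exact escapeProb_nonneg _ _
        · exact h x hx
    _ = cap B * U := by rw [cap, Finset.sum_mul]

/-! ### Fourier representation and Poissonization. -/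

open Real in
/-- The uniform probability measure on the circle `(-π, π]`. -/
def circ : Measure ℝ := ENNReal.ofReal (2 * π)⁻¹ • volume.restrict (Set.Ioc (-π) π)

open Real in
lemma integral_circ (f : ℝ → ℝ) :
    ∫ θ, f θ ∂circ = (2 * π)⁻¹ * ∫ θ in Set.Ioc (-π) π, f θ := by
  rw [circ, integral_smul_measure, ENNReal.toReal_ofReal (by positivity), smul_eq_mul]

instance : IsProbabilityMeasure circ := by
  constructor
  rw [circ, Measure.smul_apply, Measure.restrict_apply MeasurableSet.univ, Set.univ_inter,
    Real.volume_Ioc, smul_eq_mul, ← ENNReal.ofReal_mul (by positivity)]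
  rw [ENNReal.ofReal_eq_one]
  have := Real.pi_pos
  field_simp
  ring

/-- The uniform probability measure on the three-dimensional torus. -/
def torus : Measure (Fin 3 → ℝ) := Measure.pi fun _ => circ

instance : IsProbabilityMeasure torus := by unfold torus; infer_instance

/-- The characteristic function of one step of simple random walk. -/
def stepChar (θ : Fin 3 → ℝ) : ℝ := (1 / 3) * ∑ i, Real.cos (θ i)

lemma continuous_stepChar : Continuous stepChar := by unfold stepChar; fun_prop

lemma abs_stepChar_le (θ : Fin 3 → ℝ) : |stepChar θ| ≤ 1 := by
  unfold stepChar
  rw [Fin.sum_univ_three, abs_le]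
  constructor <;> linarith [Real.cos_le_one (θ 0), Real.cos_le_one (θ 1), Real.cos_le_one (θ 2),
    Real.neg_one_le_cos (θ 0), Real.neg_one_le_cos (θ 1), Real.neg_one_le_cos (θ 2)]

/-- The product of cosines `∏ᵢ cos (xᵢ θᵢ)`. -/
def cosProd (x : Lattice) (θ : Fin 3 → ℝ) : ℝ := ∏ i, Real.cos (x i * θ i)

lemma continuous_cosProd (x : Lattice) : Continuous (cosProd x) := by unfold cosProd; fun_prop

lemma abs_cosProd_le (x : Lattice) (θ : Fin 3 → ℝ) : |cosProd x θ| ≤ 1 := by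
  unfold cosProd
  rw [Finset.abs_prod]
  exact Finset.prod_le_one (fun _ _ => abs_nonneg _) fun _ _ => Real.abs_cos_le_one _

/-- By cos(a − b) + cos(a + b) = 2 cos a cos b, products of cosines are eigenfunctions of the walk,
so real cosines can replace characters. -/
lemma sum_cosProd_step (x : Lattice) (θ : Fin 3 → ℝ) :
    (1 / 6) * ∑ e, cosProd (x - step e) θ = stepChar θ * cosProd x θ := by
  have h10 : (1 : Fin 3) ≠ 0 := by decide
  have h20 : (2 : Fin 3) ≠ 0 := by decide
  have h21 : (2 : Fin 3) ≠ 1 := by decide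
  unfold cosProd stepChar
  simp only [Fintype.sum_prod_type, Fin.sum_univ_three, Fintype.sum_bool, Fin.prod_univ_three,
    step, Pi.sub_apply, Pi.single_apply, h10, h20, h21, h10.symm, h20.symm, h21.symm, if_true,
    if_false, Bool.false_eq_true, sub_zero]
  push_cast
  simp only [sub_mul, add_mul, one_mul, sub_neg_eq_add, Real.cos_sub, Real.cos_add]
  ring

lemma integrable_torus_of_continuous_of_bound {f : (Fin 3 → ℝ) → ℝ} (hf : Continuous f)
    (h : ∀ θ, |f θ| ≤ 1) : Integrable f torus :=
  Integrable.of_bound hf.aestronglyMeasurable 1 (ae_of_all _ fun θ => h θ)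

lemma integral_circ_cos (k : ℤ) : ∫ θ, Real.cos (k * θ) ∂circ = if k = 0 then 1 else 0 := by
  split_ifs with h
  · simp [h]
  · rw [integral_circ, ← intervalIntegral.integral_of_le (by linarith [Real.pi_pos])]
    have hk : (k : ℝ) ≠ 0 := by exact_mod_cast h
    have h1 : Real.sin (k * -Real.pi) = 0 := by
      rw [mul_neg, Real.sin_neg, Real.sin_int_mul_pi, neg_zero]
    rw [intervalIntegral.integral_comp_mul_left _ hk, integral_cos, h1, Real.sin_int_mul_pi]
    simp

lemma kern_eq_integral (n : ℕ) (x : Lattice) :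
    kern n x = ∫ θ, stepChar θ ^ n * cosProd x θ ∂torus := by
  have hint : ∀ n x, Integrable (fun θ => stepChar θ ^ n * cosProd x θ) torus := fun n x =>
    integrable_torus_of_continuous_of_bound
      ((continuous_stepChar.pow n).mul (continuous_cosProd x)) fun θ => by
        rw [abs_mul, abs_pow]
        exact mul_le_one₀ (pow_le_one₀ (abs_nonneg _) (abs_stepChar_le θ)) (abs_nonneg _)
          (abs_cosProd_le x θ)
  induction n generalizing x with
  | zero =>
    simp only [pow_zero, one_mul, cosProd, torus, kern]
    rw [integral_fintype_prod_eq_prod (fun i θ => Real.cos (x i * θ))]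
    simp_rw [integral_circ_cos]
    split_ifs with h
    · simp [h]
    · obtain ⟨i, hi⟩ := Function.ne_iff.1 h
      exact (Finset.prod_eq_zero (Finset.mem_univ i) (if_neg hi)).symm
  | succ n ih =>
    simp_rw [kern, ih]
    rw [← integral_finsetSum _ (fun e _ => hint n _), ← integral_const_mul]
    congr 1
    ext θ
    rw [← Finset.mul_sum, mul_left_comm, sum_cosProd_step]
    ring

/-- The transition function of the one-dimensional rate one continuous time walk. -/
def heat (t : ℝ) (k : ℤ) : ℝ := ∫ θ, Real.cos (k * θ) * Real.exp (-(t * (1 - Real.cos θ))) ∂circ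

/-- With steps at the times of a rate-one Poisson process, the coordinates are independent walks of
rate 1/3; in Fourier terms the exponential of a sum factorizes. -/
lemma hasSum_kern_heat {t : ℝ} (ht : 0 ≤ t) (x : Lattice) :
    HasSum (fun n : ℕ => Real.exp (-t) * (t ^ n / n.factorial) * kern n x)
      (∏ i, heat (t / 3) (x i)) := by
  have hexp : ∀ u : ℝ, HasSum (fun n : ℕ => Real.exp (-t) * (u ^ n / n.factorial))
      (Real.exp (-t) * Real.exp u) := fun u => by
    have := NormedSpace.expSeries_div_hasSum_exp (𝔸 := ℝ) u
    rw [← Real.exp_eq_exp_ℝ] at this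
    exact this.mul_left _
  have h := hasSum_integral_of_dominated_convergence (μ := torus)
    (F := fun (n : ℕ) θ => Real.exp (-t) * (t ^ n / n.factorial) * (stepChar θ ^ n * cosProd x θ))
    (f := fun θ => ∏ i, (Real.cos (x i * θ i) * Real.exp (-(t / 3 * (1 - Real.cos (θ i))))))
    (fun n _ => Real.exp (-t) * (t ^ n / n.factorial)) ?_ ?_ ?_ ?_ ?_
  · simp_rw [integral_const_mul, ← kern_eq_integral] at h
    rw [torus, integral_fintype_prod_eq_prod
      (fun i θ => Real.cos (x i * θ) * Real.exp (-(t / 3 * (1 - Real.cos θ))))] at h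
    exact h
  · intro n
    exact (((continuous_stepChar.pow n).mul (continuous_cosProd x)).const_smul
      (Real.exp (-t) * (t ^ n / n.factorial))).aestronglyMeasurable
  · intro n
    refine ae_of_all _ fun θ => ?_
    rw [norm_mul, Real.norm_of_nonneg (by positivity), Real.norm_eq_abs, abs_mul, abs_pow]
    refine mul_le_of_le_one_right (by positivity) ?_
    exact mul_le_one₀ (pow_le_one₀ (abs_nonneg _) (abs_stepChar_le θ)) (abs_nonneg _)
          (abs_cosProd_le x θ)
  · exact ae_of_all _ fun θ => (hexp t).summable
  · exact integrable_const _
  · refine ae_of_all _ fun θ => ?_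
    have h2 := (hexp (t * stepChar θ)).mul_right (cosProd x θ)
    have h3 : ∏ i, (Real.cos (x i * θ i) * Real.exp (-(t / 3 * (1 - Real.cos (θ i))))) =
        Real.exp (-t) * Real.exp (t * stepChar θ) * cosProd x θ := by
      rw [Finset.prod_mul_distrib, ← Real.exp_sum, ← Real.exp_add, mul_comm, cosProd]
      congr 2
      unfold stepChar
      rw [Fin.sum_univ_three, Fin.sum_univ_three]
      ring
    rw [h3]
    refine h2.congr_fun fun n => ?_
    rw [mul_pow]
    ring

lemma prod_heat_nonneg {t : ℝ} (ht : 0 ≤ t) (x : Lattice) : 0 ≤ ∏ i, heat (t / 3) (x i) := by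
  rw [← (hasSum_kern_heat ht x).tsum_eq]
  exact tsum_nonneg fun n => mul_nonneg (by positivity) (kern_nonneg n x)

lemma lintegral_exp_neg_mul_pow_div_factorial (n : ℕ) :
    ∫⁻ t in Set.Ioi (0 : ℝ), ENNReal.ofReal (Real.exp (-t) * (t ^ n / n.factorial)) = 1 := by
  have h0 : (0 : ℝ) < n + 1 := by positivity
  have hi := Real.GammaIntegral_convergent h0
  simp only [add_sub_cancel_right, Real.rpow_natCast] at hi
  have hg := Real.Gamma_eq_integral h0
  simp only [add_sub_cancel_right, Real.rpow_natCast] at hg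
  rw [Real.Gamma_nat_eq_factorial] at hg
  have heq : ∀ t : ℝ, Real.exp (-t) * (t ^ n / n.factorial) =
      Real.exp (-t) * t ^ n * (n.factorial : ℝ)⁻¹ := fun t => by ring
  simp_rw [heq]
  rw [← ofReal_integral_eq_lintegral_ofReal (hi.mul_const _)
    ((ae_restrict_iff' measurableSet_Ioi).2 (ae_of_all _ fun t ht => by
      have : (0 : ℝ) < t := ht
      positivity)), integral_mul_const, ← hg,
    mul_inv_cancel₀ (by positivity), ENNReal.ofReal_one]

lemma measurable_heat (k : ℤ) : StronglyMeasurable fun t => heat t k := by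
  unfold heat
  refine StronglyMeasurable.integral_prod_right
    (f := fun t θ => Real.cos (k * θ) * Real.exp (-(t * (1 - Real.cos θ)))) ?_
  refine Continuous.stronglyMeasurable ?_
  unfold Function.uncurry
  fun_prop

lemma measurable_prod_heat (x : Lattice) : Measurable fun t : ℝ => ∏ i, heat (t / 3) (x i) :=
  Finset.measurable_prod _ fun i _ =>
    (measurable_heat (x i)).measurable.comp (measurable_id.div_const 3)

/-- Each Poisson weight has integral 1 over time, by the Gamma integral. Stating this in `ENNReal`
allows summability of `kern` to be deduced from it. -/
lemma lintegral_prod_heat (x : Lattice) :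
    ∫⁻ t in Set.Ioi (0 : ℝ), ENNReal.ofReal (∏ i, heat (t / 3) (x i)) =
      ∑' n, ENNReal.ofReal (kern n x) := by
  have h1 : ∀ t ∈ Set.Ioi (0 : ℝ), ENNReal.ofReal (∏ i, heat (t / 3) (x i)) =
      ∑' n : ℕ, ENNReal.ofReal (Real.exp (-t) * (t ^ n / n.factorial)) *
        ENNReal.ofReal (kern n x) := by
    intro t ht
    have ht' : (0 : ℝ) < t := ht
    have h := hasSum_kern_heat ht'.le x
    rw [← h.tsum_eq, ENNReal.ofReal_tsum_of_nonneg
      (fun n => mul_nonneg (by positivity) (kern_nonneg n x)) h.summable]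
    refine tsum_congr fun n => ?_
    rw [ENNReal.ofReal_mul (by positivity)]
  rw [setLIntegral_congr_fun measurableSet_Ioi h1, lintegral_tsum]
  · refine tsum_congr fun n => ?_
    rw [lintegral_mul_const, lintegral_exp_neg_mul_pow_div_factorial, one_mul]
    exact Measurable.ennreal_ofReal (by fun_prop)
  · intro n
    exact (Measurable.ennreal_ofReal (by fun_prop)).aemeasurable.mul_const _

lemma summable_kern_of_integrableOn {x : Lattice}
    (h : IntegrableOn (fun t : ℝ => ∏ i, heat (t / 3) (x i)) (Set.Ioi 0)) :
    Summable (fun n => kern n x) := by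
  have h1 : ∑' n, ENNReal.ofReal (kern n x) ≠ ⊤ := by
    rw [← lintegral_prod_heat]
    exact h.lintegral_lt_top.ne
  have h2 := ENNReal.summable_toReal h1
  simpa [ENNReal.toReal_ofReal (kern_nonneg _ x)] using h2

lemma green_eq_integral {x : Lattice}
    (h : IntegrableOn (fun t : ℝ => ∏ i, heat (t / 3) (x i)) (Set.Ioi 0)) :
    green x = ∫ t in Set.Ioi (0 : ℝ), ∏ i, heat (t / 3) (x i) := by
  rw [integral_eq_lintegral_of_nonneg_ae _ (measurable_prod_heat x).aestronglyMeasurable,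
    lintegral_prod_heat, ← ENNReal.ofReal_tsum_of_nonneg (fun n => kern_nonneg n x)
      (summable_kern_of_integrableOn h), ENNReal.toReal_ofReal (tsum_nonneg fun n => kern_nonneg n x)]
  · rfl
  · exact (ae_restrict_iff' measurableSet_Ioi).2
      (ae_of_all _ fun t ht => prod_heat_nonneg (le_of_lt ht) x)

/-! ### One-dimensional heat kernel: decay bounds and the local limit theorem. -/

lemma exp_neg_mul_one_sub_cos_le {t θ : ℝ} (ht : 0 ≤ t) (hθ : |θ| ≤ Real.pi) :
    Real.exp (-(t * (1 - Real.cos θ))) ≤ Real.exp (-(2 * t / Real.pi ^ 2) * θ ^ 2) := by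
  have h := Real.cos_le_one_sub_mul_cos_sq hθ
  apply Real.exp_le_exp.2
  have : t * (2 / Real.pi ^ 2 * θ ^ 2) ≤ t * (1 - Real.cos θ) :=
    mul_le_mul_of_nonneg_left (by linarith) ht
  calc -(t * (1 - Real.cos θ)) ≤ -(t * (2 / Real.pi ^ 2 * θ ^ 2)) := by linarith
    _ = _ := by ring

/-- Enlarge the circle to the whole line and evaluate the Gaussian; the bound √π ≤ 2 absorbs the
remaining constant. -/
lemma abs_integral_circ_le {f : ℝ → ℝ} {c M : ℝ} (hc : 0 < c) (hM : 0 ≤ M)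
    (h : ∀ θ, |θ| ≤ Real.pi → |f θ| ≤ M * Real.exp (-(c / Real.pi ^ 2) * θ ^ 2)) :
    |∫ θ, f θ ∂circ| ≤ M / √c := by
  have hpi := Real.pi_pos
  have hc' : 0 < c / Real.pi ^ 2 := by positivity
  have hint : Integrable fun θ : ℝ => M * Real.exp (-(c / Real.pi ^ 2) * θ ^ 2) :=
    (integrable_exp_neg_mul_sq hc').const_mul M
  have h1 : |∫ θ in Set.Ioc (-Real.pi) Real.pi, f θ| ≤
      ∫ θ : ℝ, M * Real.exp (-(c / Real.pi ^ 2) * θ ^ 2) := by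
    calc |∫ θ in Set.Ioc (-Real.pi) Real.pi, f θ|
        ≤ ∫ θ in Set.Ioc (-Real.pi) Real.pi, M * Real.exp (-(c / Real.pi ^ 2) * θ ^ 2) := by
          rw [← Real.norm_eq_abs]
          refine norm_integral_le_of_norm_le hint.integrableOn ?_
          exact (ae_restrict_iff' measurableSet_Ioc).2 (ae_of_all _ fun θ hθ =>
            h θ (abs_le.2 ⟨hθ.1.le, hθ.2⟩))
      _ ≤ _ := setIntegral_le_integral hint (ae_of_all _ fun θ => by positivity)
  rw [integral_const_mul, integral_gaussian] at h1
  have h2 : √(Real.pi / (c / Real.pi ^ 2)) = √Real.pi * Real.pi / √c := by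
    rw [div_div_eq_mul_div, Real.sqrt_div (by positivity), Real.sqrt_mul hpi.le,
      Real.sqrt_sq hpi.le]
  have h3 : √Real.pi ≤ 2 := Real.sqrt_le_iff.2 ⟨by norm_num, by linarith [Real.pi_le_four]⟩
  have hsc : 0 < √c := Real.sqrt_pos.2 hc
  rw [integral_circ, abs_mul, abs_of_pos (by positivity)]
  calc (2 * Real.pi)⁻¹ * |∫ θ in Set.Ioc (-Real.pi) Real.pi, f θ|
      ≤ (2 * Real.pi)⁻¹ * (M * (2 * Real.pi / √c)) := by
        refine mul_le_mul_of_nonneg_left (h1.trans ?_) (by positivity)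
        rw [h2]
        gcongr
    _ = M / √c := by field_simp

lemma abs_heat_le {t : ℝ} (ht : 0 < t) (k : ℤ) : |heat t k| ≤ 1 / √t := by
  have h := abs_integral_circ_le (f := fun θ => Real.cos (k * θ) *
    Real.exp (-(t * (1 - Real.cos θ)))) (c := 2 * t) (M := 1) (by positivity) zero_le_one
    fun θ hθ => by
      rw [abs_mul, abs_of_pos (Real.exp_pos _)]
      exact mul_le_mul (Real.abs_cos_le_one _) (exp_neg_mul_one_sub_cos_le ht.le hθ)
        (Real.exp_pos _).le zero_le_one
  refine h.trans ?_
  have : √t ≤ √(2 * t) := Real.sqrt_le_sqrt (by linarith)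
  have h0 : 0 < √t := Real.sqrt_pos.2 ht
  gcongr

/-- Two integrations by parts, done at once by differentiating the combined boundary expression; it
vanishes at ±π because sin(kπ) = sin π = 0. -/
lemma sq_mul_heat (t : ℝ) (k : ℤ) :
    (k : ℝ) ^ 2 * heat t k = -∫ θ, Real.cos (k * θ) * ((t ^ 2 * Real.sin θ ^ 2 - t * Real.cos θ) *
      Real.exp (-(t * (1 - Real.cos θ)))) ∂circ := by
  set E : ℝ → ℝ := fun θ => Real.exp (-(t * (1 - Real.cos θ))) with hE
  have hEc : Continuous E := by fun_prop
  have hdE : ∀ θ, HasDerivAt E (-(t * Real.sin θ) * E θ) θ := by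
    intro θ
    have h : HasDerivAt E (E θ * -(t * - -Real.sin θ)) θ :=
      (((Real.hasDerivAt_cos θ).const_sub 1).const_mul t).neg.exp
    exact h.congr_deriv (by ring)
  have hd : ∀ θ : ℝ, HasDerivAt
      (fun θ => k * (Real.sin (k * θ) * E θ) + Real.cos (k * θ) * (-(t * Real.sin θ) * E θ))
      ((k : ℝ) ^ 2 * (Real.cos (k * θ) * E θ) + Real.cos (k * θ) *
        ((t ^ 2 * Real.sin θ ^ 2 - t * Real.cos θ) * E θ)) θ := by
    intro θ
    have hk : HasDerivAt (fun θ : ℝ => (k : ℝ) * θ) k θ := by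
      simpa using (hasDerivAt_id θ).const_mul (k : ℝ)
    have h1 := ((hk.sin.mul (hdE θ)).const_mul (k : ℝ)).add
      (hk.cos.mul ((((Real.hasDerivAt_sin θ).const_mul t).neg).mul (hdE θ)))
    refine h1.congr_deriv ?_
    simp only [Pi.neg_apply, Pi.mul_apply]
    ring
  have hftc := intervalIntegral.integral_eq_sub_of_hasDerivAt (a := -Real.pi) (b := Real.pi)
    (fun θ _ => hd θ) (by
      apply Continuous.intervalIntegrable
      fun_prop)
  have hle : -Real.pi ≤ Real.pi := by linarith [Real.pi_pos]
  have hs : Real.sin (k * -Real.pi) = 0 := by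
    rw [mul_neg, Real.sin_neg, Real.sin_int_mul_pi, neg_zero]
  rw [hs, Real.sin_int_mul_pi, Real.sin_neg, Real.sin_pi, intervalIntegral.integral_of_le hle,
    integral_add, integral_const_mul] at hftc
  · rw [heat, integral_circ, integral_circ]
    linear_combination (2 * Real.pi)⁻¹ * hftc
  · exact (Continuous.integrableOn_Ioc (by fun_prop))
  · exact (Continuous.integrableOn_Ioc (by fun_prop))

/-- This off-diagonal decay is what later makes the rescaled kernel integrable near time 0. -/
lemma sq_mul_abs_heat_le {t : ℝ} (ht : 0 < t) (k : ℤ) :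
    (k : ℝ) ^ 2 * |heat t k| ≤ 20 * √t := by
  have hpi := Real.pi_pos
  have hpi2 : Real.pi ^ 2 ≤ 16 := by nlinarith [Real.pi_le_four]
  have h := abs_integral_circ_le (f := fun θ => Real.cos (k * θ) *
    ((t ^ 2 * Real.sin θ ^ 2 - t * Real.cos θ) * Real.exp (-(t * (1 - Real.cos θ)))))
    (c := t) (M := 20 * t) ht (by positivity) fun θ hθ => by
      -- Half of the Gaussian exponent pays for the polynomial factor through u + 1 ≤ exp u. The
      -- constant 20 leaves room for 16 ≥ π² plus 1.
      have h1 : |t ^ 2 * Real.sin θ ^ 2 - t * Real.cos θ| ≤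
          20 * t * Real.exp ((t / Real.pi ^ 2) * θ ^ 2) := by
        set u := (t / Real.pi ^ 2) * θ ^ 2 with hu
        have hu0 : 0 ≤ u := by positivity
        have h2 : t ^ 2 * Real.sin θ ^ 2 ≤ 16 * t * u := by
          have h3 : Real.sin θ ^ 2 ≤ θ ^ 2 := sq_le_sq.2 Real.abs_sin_le_abs
          calc t ^ 2 * Real.sin θ ^ 2 ≤ t ^ 2 * θ ^ 2 := by gcongr
            _ = Real.pi ^ 2 * t * u := by rw [hu]; field_simp
            _ ≤ 16 * t * u := by gcongr
        have h4 : u + 1 ≤ Real.exp u := Real.add_one_le_exp u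
        have h5 : |t * Real.cos θ| ≤ t := by
          rw [abs_mul, abs_of_pos ht]
          exact mul_le_of_le_one_right ht.le (Real.abs_cos_le_one θ)
        calc |t ^ 2 * Real.sin θ ^ 2 - t * Real.cos θ|
            ≤ |t ^ 2 * Real.sin θ ^ 2| + |t * Real.cos θ| := abs_sub _ _
          _ ≤ 16 * t * u + t := by
              rw [abs_of_nonneg (by positivity : 0 ≤ t ^ 2 * Real.sin θ ^ 2)]
              linarith
          _ ≤ 20 * t * (u + 1) := by nlinarith [mul_nonneg ht.le hu0]
          _ ≤ _ := by gcongr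
      rw [abs_mul, abs_mul, abs_of_pos (Real.exp_pos _)]
      calc |Real.cos (k * θ)| * (|t ^ 2 * Real.sin θ ^ 2 - t * Real.cos θ| *
            Real.exp (-(t * (1 - Real.cos θ))))
          ≤ 1 * ((20 * t * Real.exp ((t / Real.pi ^ 2) * θ ^ 2)) *
            Real.exp (-(2 * t / Real.pi ^ 2) * θ ^ 2)) := by
            gcongr
            · exact Real.abs_cos_le_one _
            · exact Real.exp_le_exp.1 (exp_neg_mul_one_sub_cos_le ht.le hθ)
        _ = 20 * t * Real.exp (-(t / Real.pi ^ 2) * θ ^ 2) := by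
            rw [one_mul, mul_assoc, ← Real.exp_add]
            congr 2
            ring
  have h6 : (k : ℝ) ^ 2 * |heat t k| = |(k : ℝ) ^ 2 * heat t k| := by
    rw [abs_mul, abs_of_nonneg (sq_nonneg (k : ℝ))]
  rw [h6, sq_mul_heat, abs_neg]
  refine h.trans (le_of_eq ?_)
  rw [mul_div_assoc, Real.div_sqrt]

/-- The inverse Fourier transform of the one-dimensional Gaussian. -/
lemma integral_cos_mul_exp_neg_sq {a : ℝ} (ha : 0 < a) (u : ℝ) :
    (2 * Real.pi)⁻¹ * ∫ v : ℝ, Real.cos (u * v) * Real.exp (-(a / 2) * v ^ 2) =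
      (√(2 * Real.pi * a))⁻¹ * Real.exp (-(u ^ 2 / (2 * a))) := by
  have hpi := Real.pi_pos
  have h := fourierIntegral_gaussian (b := ((a / 2 : ℝ) : ℂ)) (by simpa using ha) (u : ℂ)
  have hint : Integrable fun v : ℝ => Complex.exp (Complex.I * u * v) *
      Complex.exp (-((a / 2 : ℝ) : ℂ) * v ^ 2) := by
    have := integrable_cexp_quadratic (b := ((a / 2 : ℝ) : ℂ)) (by simpa using ha)
      (Complex.I * u) 0
    refine this.congr (ae_of_all _ fun v => ?_)
    simp only
    rw [← Complex.exp_add]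
    congr 1
    ring
  have hre := congrArg Complex.re h
  rw [← RCLike.re_eq_complex_re, ← integral_re hint] at hre
  have h1 : ∀ v : ℝ, RCLike.re (Complex.exp (Complex.I * u * v) *
      Complex.exp (-((a / 2 : ℝ) : ℂ) * v ^ 2)) =
      Real.cos (u * v) * Real.exp (-(a / 2) * v ^ 2) := by
    intro v
    have e1 : Complex.exp (-((a / 2 : ℝ) : ℂ) * v ^ 2) =
        ((Real.exp (-(a / 2) * v ^ 2) : ℝ) : ℂ) := by push_cast; ring_nf
    have e2 : Complex.I * u * v = ((u * v : ℝ) : ℂ) * Complex.I := by push_cast; ring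
    rw [e1, e2, RCLike.re_eq_complex_re, Complex.re_mul_ofReal, Complex.exp_ofReal_mul_I_re]
  simp_rw [h1] at hre
  rw [hre]
  have h2 : ((Real.pi : ℂ) / ((a / 2 : ℝ) : ℂ)) ^ (1 / 2 : ℂ) *
      Complex.exp (-(u : ℂ) ^ 2 / (4 * ((a / 2 : ℝ) : ℂ))) =
      ((√(Real.pi / (a / 2)) * Real.exp (-(u ^ 2 / (2 * a))) : ℝ) : ℂ) := by
    rw [Real.sqrt_eq_rpow, Complex.ofReal_mul, Complex.ofReal_cpow (by positivity)]
    push_cast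
    congr 2
    ring
  rw [h2, RCLike.re_eq_complex_re, Complex.ofReal_re, ← mul_assoc]
  congr 1
  have h3 : Real.pi / (a / 2) = (2 * Real.pi) ^ 2 / (2 * Real.pi * a) := by
    field_simp
  rw [h3, Real.sqrt_div (by positivity), Real.sqrt_sq (by positivity)]
  field_simp

/-- The `L¹` distance between the rescaled characteristic function of the one-dimensional
walk and that of the Gaussian. -/
def charDist (a R : ℝ) : ℝ :=
  ∫ v : ℝ, |(Set.Ioc (-Real.pi) Real.pi).indicator
    (fun θ => Real.exp (-(R ^ 2 * a * (1 - Real.cos θ)))) (v / R) - Real.exp (-(a / 2) * v ^ 2)|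

lemma indicator_exp_le {a R : ℝ} (ha : 0 ≤ a) (hR : 0 < R) (v : ℝ) :
    (Set.Ioc (-Real.pi) Real.pi).indicator
    (fun θ => Real.exp (-(R ^ 2 * a * (1 - Real.cos θ)))) (v / R) ≤
      Real.exp (-(2 * a / Real.pi ^ 2) * v ^ 2) := by
  by_cases h : v / R ∈ Set.Ioc (-Real.pi) Real.pi
  · rw [Set.indicator_of_mem h]
    refine (exp_neg_mul_one_sub_cos_le (by positivity) (abs_le.2 ⟨h.1.le, h.2⟩)).trans
      (le_of_eq ?_)
    congr 1
    field_simp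
  · rw [Set.indicator_of_notMem h]
    positivity

lemma measurable_indicator_exp (a R : ℝ) : Measurable fun v : ℝ =>
    (Set.Ioc (-Real.pi) Real.pi).indicator
      (fun θ => Real.exp (-(R ^ 2 * a * (1 - Real.cos θ)))) (v / R) := by
  have h : Measurable ((Set.Ioc (-Real.pi) Real.pi).indicator
      (fun θ => Real.exp (-(R ^ 2 * a * (1 - Real.cos θ))))) :=
    Measurable.indicator (by fun_prop) measurableSet_Ioc
  exact h.comp (measurable_id.div_const R)

lemma exp_neg_half_mul_sq_le {a : ℝ} (ha : 0 ≤ a) (v : ℝ) : Real.exp (-(a / 2) * v ^ 2) ≤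
      Real.exp (-(2 * a / Real.pi ^ 2) * v ^ 2) := by
  apply Real.exp_le_exp.2
  have h9 : 4 ≤ Real.pi ^ 2 := by nlinarith [Real.pi_gt_three]
  have : 2 * a / Real.pi ^ 2 ≤ a / 2 := by
    rw [div_le_div_iff₀ (by positivity) (by norm_num)]
    nlinarith
  nlinarith [sq_nonneg v]

lemma tendsto_sq_mul_one_sub_cos (v : ℝ) :
    Tendsto (fun R : ℝ => R ^ 2 * (1 - Real.cos (v / R))) atTop (𝓝 (v ^ 2 / 2)) := by
  rw [tendsto_iff_norm_sub_tendsto_zero]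
  have hlim : Tendsto (fun R : ℝ => |v| ^ 4 * (5 / 96) / R ^ 2) atTop (𝓝 0) :=
    tendsto_const_nhds.div_atTop (tendsto_pow_atTop two_ne_zero)
  refine squeeze_zero' (Eventually.of_forall fun _ => norm_nonneg _) ?_ hlim
  filter_upwards [eventually_ge_atTop |v|, eventually_gt_atTop 0] with R hR hR0
  have h1 : |v / R| ≤ 1 := by
    rw [abs_div, abs_of_pos hR0]
    exact div_le_one_of_le₀ hR hR0.le
  have h2 := Real.cos_bound h1
  have h3 : R ^ 2 * (1 - Real.cos (v / R)) - v ^ 2 / 2 =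
      -(R ^ 2 * (Real.cos (v / R) - (1 - (v / R) ^ 2 / 2))) := by
    field_simp
    ring
  rw [h3, norm_neg, norm_mul, Real.norm_of_nonneg (by positivity), Real.norm_eq_abs]
  calc R ^ 2 * |Real.cos (v / R) - (1 - (v / R) ^ 2 / 2)|
      ≤ R ^ 2 * (|v / R| ^ 4 * (5 / 96)) := by gcongr
    _ = |v| ^ 4 * (5 / 96) / R ^ 2 := by
        rw [abs_div, abs_of_pos hR0]
        field_simp

lemma tendsto_charDist {a : ℝ} (ha : 0 < a) : Tendsto (charDist a) atTop (𝓝 0) := by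
  have hpi := Real.pi_pos
  have h := tendsto_integral_filter_of_dominated_convergence (μ := volume) (l := atTop)
    (F := fun (R v : ℝ) => |(Set.Ioc (-Real.pi) Real.pi).indicator
      (fun θ => Real.exp (-(R ^ 2 * a * (1 - Real.cos θ)))) (v / R) -
        Real.exp (-(a / 2) * v ^ 2)|) (f := fun _ => (0 : ℝ))
    (fun v => Real.exp (-(2 * a / Real.pi ^ 2) * v ^ 2)) ?_ ?_ ?_ ?_
  · rw [integral_zero] at h
    exact h
  · refine Eventually.of_forall fun R => ?_
    refine Measurable.aestronglyMeasurable ?_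
    exact ((measurable_indicator_exp a R).sub (by fun_prop)).abs
  · filter_upwards [eventually_gt_atTop 0] with R hR
    refine ae_of_all _ fun v => ?_
    rw [Real.norm_eq_abs, abs_abs]
    exact abs_sub_le_of_nonneg_of_le
      (Set.indicator_nonneg (fun _ _ => (Real.exp_pos _).le) _)
      (indicator_exp_le ha.le hR v) (Real.exp_pos _).le (exp_neg_half_mul_sq_le ha.le v)
  · exact integrable_exp_neg_mul_sq (by positivity)
  · refine ae_of_all _ fun v => ?_
    have h1 : Tendsto (fun R : ℝ => Real.exp (-(a * (R ^ 2 * (1 - Real.cos (v / R)))))) atTop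
        (𝓝 (Real.exp (-(a * (v ^ 2 / 2))))) :=
      ((tendsto_sq_mul_one_sub_cos v).const_mul a).neg.rexp
    have h2 : Tendsto (fun R : ℝ => |Real.exp (-(a * (R ^ 2 * (1 - Real.cos (v / R))))) -
        Real.exp (-(a / 2) * v ^ 2)|) atTop (𝓝 0) := by
      have := (h1.sub_const (Real.exp (-(a / 2) * v ^ 2))).abs
      rwa [show -(a * (v ^ 2 / 2)) = -(a / 2) * v ^ 2 by ring, sub_self, abs_zero] at this
    refine h2.congr' ?_
    filter_upwards [eventually_gt_atTop (|v|), eventually_gt_atTop 0] with R hR hR0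
    have h3 : |v / R| < 1 := by
      rw [abs_div, abs_of_pos hR0]
      exact (div_lt_one hR0).2 hR
    have h4 := abs_lt.1 h3
    rw [Set.indicator_of_mem (show v / R ∈ Set.Ioc (-Real.pi) Real.pi from
      ⟨by linarith [Real.pi_gt_three], by linarith [Real.pi_gt_three]⟩)]
    ring_nf

/-- After the substitution θ = v/R both terms are cosine transforms, and |cos| ≤ 1 bounds their
difference uniformly in `k`. -/
lemma abs_mul_heat_sub_gaussian_le {a R : ℝ} (ha : 0 < a) (hR : 0 < R) (k : ℤ) :
    |R * heat (R ^ 2 * a) k - (√(2 * Real.pi * a))⁻¹ * Real.exp (-((k / R) ^ 2 / (2 * a)))| ≤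
      charDist a R := by
  have hpi := Real.pi_pos
  have hgi : Integrable fun v : ℝ => Real.exp (-(2 * a / Real.pi ^ 2) * v ^ 2) :=
    integrable_exp_neg_mul_sq (by positivity)
  set I : ℝ → ℝ := fun v => (Set.Ioc (-Real.pi) Real.pi).indicator
    (fun θ => Real.exp (-(R ^ 2 * a * (1 - Real.cos θ)))) (v / R) with hI
  set g : ℝ → ℝ := fun v => Real.exp (-(a / 2) * v ^ 2) with hg
  have hIi : Integrable I := hgi.mono' (measurable_indicator_exp a R).aestronglyMeasurable
    (ae_of_all _ fun v => by
      rw [Real.norm_of_nonneg (Set.indicator_nonneg (fun _ _ => (Real.exp_pos _).le) _)]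
      exact indicator_exp_le ha.le hR v)
  have hgi' : Integrable g := integrable_exp_neg_mul_sq (by positivity)
  have hcos : ∀ f : ℝ → ℝ, Integrable f → Integrable fun v => Real.cos (k / R * v) * f v :=
    fun f hf => hf.bdd_mul (c := 1) (by fun_prop) (ae_of_all _ fun v => Real.abs_cos_le_one _)
  have h1 : R * heat (R ^ 2 * a) k = (2 * Real.pi)⁻¹ * ∫ v, Real.cos (k / R * v) * I v := by
    have h2 := Measure.integral_comp_div ((Set.Ioc (-Real.pi) Real.pi).indicator
      (fun θ => Real.cos (k * θ) * Real.exp (-(R ^ 2 * a * (1 - Real.cos θ))))) R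
    rw [integral_indicator measurableSet_Ioc, abs_of_pos hR, smul_eq_mul] at h2
    rw [heat, integral_circ, mul_left_comm, ← h2]
    congr 1
    refine integral_congr_ae (ae_of_all _ fun v => ?_)
    simp only [hI]
    by_cases h : v / R ∈ Set.Ioc (-Real.pi) Real.pi
    · rw [Set.indicator_of_mem h, Set.indicator_of_mem h, div_mul_eq_mul_div, mul_div_assoc]
    · rw [Set.indicator_of_notMem h, Set.indicator_of_notMem h, mul_zero]
  rw [h1, ← integral_cos_mul_exp_neg_sq ha, ← mul_sub, ← integral_sub (hcos I hIi) (hcos g hgi'),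
    abs_mul, abs_of_pos (by positivity)]
  have h3 : |∫ v, (Real.cos (k / R * v) * I v - Real.cos (k / R * v) * g v)| ≤ charDist a R := by
    rw [← Real.norm_eq_abs]
    refine norm_integral_le_of_norm_le (hIi.sub hgi').abs (ae_of_all _ fun v => ?_)
    rw [← mul_sub, norm_mul]
    exact mul_le_of_le_one_left (norm_nonneg _) (Real.abs_cos_le_one _)
  refine le_trans (mul_le_of_le_one_left (abs_nonneg _) ?_) h3
  rw [inv_le_one₀ (by positivity)]
  linarith [Real.pi_gt_three]

/-! ### Euclidean norm and asymptotics of the Green function. -/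

lemma euclNorm_sq (x : Lattice) : euclNorm x ^ 2 = ∑ i, (x i : ℝ) ^ 2 :=
  Real.sq_sqrt (Finset.sum_nonneg fun _ _ => sq_nonneg _)

lemma euclNorm_eq_norm (x : Lattice) :
    euclNorm x = ‖(WithLp.toLp 2 (fun i => (x i : ℝ)) : EuclideanSpace ℝ (Fin 3))‖ := by
  rw [EuclideanSpace.norm_eq, euclNorm]
  simp

lemma euclNorm_add_le (x y : Lattice) : euclNorm (x + y) ≤ euclNorm x + euclNorm y := by
  simp only [euclNorm_eq_norm]
  refine le_trans (le_of_eq ?_) (norm_add_le _ _)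
  congr 1
  ext i
  simp

lemma euclNorm_neg (x : Lattice) : euclNorm (-x) = euclNorm x := by simp [euclNorm]

lemma euclNorm_sub_comm (x y : Lattice) : euclNorm (x - y) = euclNorm (y - x) := by
  rw [← euclNorm_neg, neg_sub]

lemma abs_coord_le_euclNorm (x : Lattice) (i : Fin 3) : |(x i : ℝ)| ≤ euclNorm x := by
  refine Real.abs_le_sqrt ?_
  exact Finset.single_le_sum (f := fun i => (x i : ℝ) ^ 2) (fun _ _ => sq_nonneg _)
    (Finset.mem_univ i)

lemma one_le_euclNorm {x : Lattice} (hx : x ≠ 0) : 1 ≤ euclNorm x := by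
  obtain ⟨i, hi⟩ := Function.ne_iff.1 hx
  refine le_trans ?_ (abs_coord_le_euclNorm x i)
  exact_mod_cast Int.one_le_abs hi

lemma finite_euclNorm_le (K : ℝ) : {x : Lattice | euclNorm x ≤ K}.Finite := by
  refine (Set.Finite.pi' (t := fun _ : Fin 3 => Set.Icc (-⌈K⌉) ⌈K⌉)
    fun _ => Set.finite_Icc _ _).subset fun x hx i => ?_
  have h := abs_le.1 ((abs_coord_le_euclNorm x i).trans (le_trans hx (Int.le_ceil K)))
  exact ⟨by exact_mod_cast h.1, by exact_mod_cast h.2⟩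

lemma exists_sq_euclNorm_le (x : Lattice) : ∃ i, euclNorm x ^ 2 ≤ 3 * (x i : ℝ) ^ 2 := by
  by_contra! h
  have := euclNorm_sq x
  rw [Fin.sum_univ_three] at this
  linarith [h 0, h 1, h 2]

lemma abs_heat_le_one {t : ℝ} (ht : 0 ≤ t) (k : ℤ) : |heat t k| ≤ 1 := by
  have h : ∀ θ : ℝ, ‖Real.cos (k * θ) * Real.exp (-(t * (1 - Real.cos θ)))‖ ≤ 1 := fun θ => by
    rw [norm_mul, Real.norm_of_nonneg (Real.exp_pos _).le]
    refine mul_le_one₀ (Real.abs_cos_le_one _) (Real.exp_pos _).le (Real.exp_le_one_iff.2 ?_)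
    have := mul_nonneg ht (sub_nonneg.2 (Real.cos_le_one θ))
    linarith
  have := norm_integral_le_of_norm_le_const (μ := circ) (ae_of_all _ h)
  simpa [heat] using this

lemma one_div_sqrt_div_three {s : ℝ} (hs : 0 < s) : 1 / √(s / 3) = √3 * s ^ (-(1 / 2) : ℝ) := by
  rw [Real.sqrt_div hs.le, one_div_div, Real.rpow_neg hs.le, ← Real.sqrt_eq_rpow, div_eq_mul_inv]

lemma one_div_sqrt_div_three_pow {s : ℝ} (hs : 0 < s) :
    (1 / √(s / 3)) ^ 3 = √3 ^ 3 * s ^ (-(3 / 2) : ℝ) := by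
  rw [one_div_sqrt_div_three hs, mul_pow, ← Real.rpow_natCast, ← Real.rpow_natCast,
    ← Real.rpow_mul hs.le]
  norm_num

lemma integrableOn_Ioi_of_le_rpow {f : ℝ → ℝ} (hf : Measurable f) {C D : ℝ}
    (h1 : ∀ s, 0 < s → s ≤ 1 → |f s| ≤ C * s ^ (-(1 / 2) : ℝ))
    (h2 : ∀ s, 1 < s → |f s| ≤ D * s ^ (-(3 / 2) : ℝ)) :
    IntegrableOn f (Set.Ioi 0) := by
  rw [← Set.Ioc_union_Ioi_eq_Ioi zero_le_one]
  refine IntegrableOn.union ?_ ?_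
  · have h : IntegrableOn (fun s : ℝ => s ^ (-(1 / 2) : ℝ)) (Set.Ioc 0 1) := by
      rw [← intervalIntegrable_iff_integrableOn_Ioc_of_le zero_le_one]
      exact intervalIntegral.intervalIntegrable_rpow' (by norm_num)
    refine (h.const_mul C).mono' hf.aestronglyMeasurable ?_
    exact (ae_restrict_iff' measurableSet_Ioc).2 (ae_of_all _ fun s hs => h1 s hs.1 hs.2)
  · have h : IntegrableOn (fun s : ℝ => s ^ (-(3 / 2) : ℝ)) (Set.Ioi 1) :=
      integrableOn_Ioi_rpow_of_lt (by norm_num) one_pos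
    refine (h.const_mul D).mono' hf.aestronglyMeasurable ?_
    exact (ae_restrict_iff' measurableSet_Ioi).2 (ae_of_all _ fun s hs => h2 s hs)

lemma prod_abs_le_pow_card {ι : Type*} (s : Finset ι) {f : ι → ℝ} {c : ℝ}
    (h : ∀ i ∈ s, |f i| ≤ c) : ∏ i ∈ s, |f i| ≤ c ^ s.card := by
  rw [← Finset.prod_const]
  exact Finset.prod_le_prod (fun _ _ => abs_nonneg _) h

lemma integrableOn_prod_heat (x : Lattice) :
    IntegrableOn (fun t : ℝ => ∏ i, heat (t / 3) (x i)) (Set.Ioi 0) := by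
  refine integrableOn_Ioi_of_le_rpow (measurable_prod_heat x) (C := 1) (D := √3 ^ 3) ?_ ?_
  · intro s hs hs1
    rw [Finset.abs_prod, one_mul]
    refine le_trans (Finset.prod_le_one (fun _ _ => abs_nonneg _)
      fun i _ => abs_heat_le_one (by positivity) _) ?_
    exact Real.one_le_rpow_of_pos_of_le_one_of_nonpos hs hs1 (by norm_num)
  · intro s hs
    have hs0 : 0 < s := by linarith
    rw [Finset.abs_prod, ← one_div_sqrt_div_three_pow hs0]
    refine (prod_abs_le_pow_card _ fun i _ => abs_heat_le (by positivity) _).trans ?_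
    simp

lemma summable_kern (x : Lattice) : Summable fun n => kern n x :=
  summable_kern_of_integrableOn (integrableOn_prod_heat x)

/-- The integrand of `|x| G(x)` in the diffusive time scale. -/
def scaledHeat (x : Lattice) (s : ℝ) : ℝ :=
  ∏ i, (euclNorm x * heat (euclNorm x ^ 2 * (s / 3)) (x i))

/-- Substitute t = |x|² s; the resulting factor |x|³ is shared equally among the three coordinates.
-/
lemma euclNorm_mul_green {x : Lattice} (hx : 0 < euclNorm x) :
    euclNorm x * green x = ∫ s in Set.Ioi (0 : ℝ), scaledHeat x s := by
  have h := integral_comp_mul_left_Ioi (fun t : ℝ => ∏ i, heat (t / 3) (x i)) 0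
    (b := euclNorm x ^ 2) (by positivity)
  rw [mul_zero, ← green_eq_integral (integrableOn_prod_heat x), smul_eq_mul] at h
  have h2 : ∀ s, scaledHeat x s = euclNorm x ^ 3 * ∏ i, heat (euclNorm x ^ 2 * s / 3) (x i) := by
    intro s
    rw [scaledHeat, Finset.prod_mul_distrib]
    simp [mul_div_assoc]
  simp_rw [h2]
  rw [integral_const_mul, h]
  field_simp

lemma abs_mul_heat_le {R a : ℝ} (hR : 0 < R) (ha : 0 < a) (k : ℤ) :
    |R * heat (R ^ 2 * a) k| ≤ 1 / √a := by
  have h := abs_heat_le (t := R ^ 2 * a) (by positivity) k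
  rw [Real.sqrt_mul (by positivity), Real.sqrt_sq hR.le] at h
  rw [abs_mul, abs_of_pos hR]
  calc R * |heat (R ^ 2 * a) k| ≤ R * (1 / (R * √a)) := by gcongr
    _ = 1 / √a := by
      have : 0 < √a := Real.sqrt_pos.2 ha
      field_simp

lemma abs_mul_heat_le' {R a : ℝ} (hR : 0 < R) (ha : 0 < a) {k : ℤ} (hk : R ^ 2 ≤ 3 * (k : ℝ) ^ 2) :
    |R * heat (R ^ 2 * a) k| ≤ 60 * √a := by
  have h := sq_mul_abs_heat_le (t := R ^ 2 * a) (by positivity) k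
  rw [Real.sqrt_mul (by positivity), Real.sqrt_sq hR.le] at h
  rw [abs_mul, abs_of_pos hR]
  have h1 : R ^ 2 * |heat (R ^ 2 * a) k| ≤ 3 * (k : ℝ) ^ 2 * |heat (R ^ 2 * a) k| := by gcongr
  have h2 : R * (R * |heat (R ^ 2 * a) k|) ≤ R * (60 * √a) := by linarith
  exact le_of_mul_le_mul_left h2 hR

lemma abs_scaledHeat_le {x : Lattice} (hx : 0 < euclNorm x) {s : ℝ} (hs : 0 < s) :
    |scaledHeat x s| ≤ (1 / √(s / 3)) ^ 3 := by
  rw [scaledHeat, Finset.abs_prod]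
  refine (prod_abs_le_pow_card _ fun i _ => abs_mul_heat_le hx (by positivity) _).trans ?_
  simp

/-- Some coordinate carries a third of |x|², so its factor is O(√s). This lowers the singularity at
0 from s^(−3/2) to the integrable s^(−1/2). -/
lemma abs_scaledHeat_le' {x : Lattice} (hx : 0 < euclNorm x) {s : ℝ} (hs : 0 < s) :
    |scaledHeat x s| ≤ 60 * (1 / √(s / 3)) := by
  obtain ⟨i, hi⟩ := exists_sq_euclNorm_le x
  have ha : 0 < s / 3 := by positivity
  have hsq : 0 < √(s / 3) := Real.sqrt_pos.2 ha
  rw [scaledHeat, Finset.abs_prod, ← Finset.mul_prod_erase _ _ (Finset.mem_univ i)]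
  calc _ ≤ 60 * √(s / 3) * (1 / √(s / 3)) ^ (Finset.univ.erase i).card :=
        mul_le_mul (abs_mul_heat_le' hx ha hi)
          (prod_abs_le_pow_card _ fun j _ => abs_mul_heat_le hx ha _)
          (Finset.prod_nonneg fun _ _ => abs_nonneg _) (by positivity)
    _ = 60 * (1 / √(s / 3)) := by
        rw [Finset.card_erase_of_mem (Finset.mem_univ i)]
        simp only [Finset.card_univ, Fintype.card_fin]
        norm_num
        field_simp

/-- The three-dimensional Gaussian density at a unit vector, as a function of time. -/
def gaussLimit (s : ℝ) : ℝ :=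
  (√(2 * Real.pi * (s / 3)))⁻¹ ^ 3 * Real.exp (-(1 / (2 * (s / 3))))

lemma prod_gaussian_eq {x : Lattice} (hx : 0 < euclNorm x) (s : ℝ) :
    ∏ i, ((√(2 * Real.pi * (s / 3)))⁻¹ *
      Real.exp (-((x i / euclNorm x) ^ 2 / (2 * (s / 3))))) = gaussLimit s := by
  rw [Finset.prod_mul_distrib, ← Real.exp_sum, gaussLimit]
  congr 2
  · simp
  · rw [Finset.sum_neg_distrib, ← Finset.sum_div]
    congr 2
    simp_rw [div_pow]
    rw [← Finset.sum_div, ← euclNorm_sq, div_self (by positivity)]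

lemma abs_prod_three_sub_le {a b : Fin 3 → ℝ} {M d : ℝ} (ha : ∀ i, |a i| ≤ M)
    (hb : ∀ i, |b i| ≤ M) (hd : ∀ i, |a i - b i| ≤ d) :
    |∏ i, a i - ∏ i, b i| ≤ 3 * M ^ 2 * d := by
  have hM : 0 ≤ M := (abs_nonneg _).trans (ha 0)
  have hd0 : 0 ≤ d := (abs_nonneg _).trans (hd 0)
  rw [Fin.prod_univ_three, Fin.prod_univ_three]
  have h : a 0 * a 1 * a 2 - b 0 * b 1 * b 2 = (a 0 - b 0) * (a 1 * a 2) +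
      (a 1 - b 1) * (b 0 * a 2) + (a 2 - b 2) * (b 0 * b 1) := by ring
  have key : ∀ p q r : ℝ, |p| ≤ d → |q| ≤ M → |r| ≤ M → |p * (q * r)| ≤ M ^ 2 * d := by
    intro p q r hp hq hr
    rw [abs_mul, abs_mul]
    calc |p| * (|q| * |r|) ≤ d * (M * M) := by gcongr
      _ = M ^ 2 * d := by ring
  rw [h]
  refine (abs_add_three _ _ _).trans ?_
  linarith [key _ _ _ (hd 0) (ha 1) (ha 2), key _ _ _ (hd 1) (hb 0) (ha 2),
    key _ _ _ (hd 2) (hb 0) (hb 1)]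

lemma tendsto_scaledHeat {s : ℝ} (hs : 0 < s) :
    Tendsto (fun x => scaledHeat x s) (comap euclNorm atTop) (𝓝 (gaussLimit s)) := by
  have ha : 0 < s / 3 := by positivity
  have hsq : 0 < √(s / 3) := Real.sqrt_pos.2 ha
  rw [tendsto_iff_norm_sub_tendsto_zero]
  have hlim : Tendsto (fun x : Lattice => 3 * (1 / √(s / 3)) ^ 2 * charDist (s / 3) (euclNorm x))
      (comap euclNorm atTop) (𝓝 0) := by
    have := ((tendsto_charDist ha).comp (tendsto_comap (f := euclNorm))).const_mul
      (3 * (1 / √(s / 3)) ^ 2)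
    rwa [mul_zero] at this
  refine squeeze_zero' (Eventually.of_forall fun _ => norm_nonneg _) ?_ hlim
  filter_upwards [tendsto_comap.eventually (eventually_gt_atTop (0 : ℝ))] with x hx
  rw [← prod_gaussian_eq hx s, scaledHeat, Real.norm_eq_abs]
  refine abs_prod_three_sub_le (fun i => abs_mul_heat_le hx ha _) (fun i => ?_)
    fun i => abs_mul_heat_sub_gaussian_le ha hx (x i)
  rw [abs_mul, abs_of_pos (Real.exp_pos _), abs_of_nonneg (by positivity), one_div]
  refine le_trans (mul_le_of_le_one_right (by positivity) (Real.exp_le_one_iff.2 ?_)) ?_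
  · have : 0 ≤ ((x i : ℝ) / euclNorm x) ^ 2 / (2 * (s / 3)) := by positivity
    linarith
  · refine inv_anti₀ hsq (Real.sqrt_le_sqrt ?_)
    nlinarith [Real.pi_gt_three]

/-- The substitution s = y⁻² cancels the power of s and leaves a Gaussian integral on the half-line.
-/
lemma integral_gaussLimit : ∫ s in Set.Ioi (0 : ℝ), gaussLimit s = 3 / (2 * Real.pi) := by
  have hpi := Real.pi_pos
  rw [← integral_comp_rpow_Ioi gaussLimit (p := -2) (by norm_num)]
  have h : ∀ y ∈ Set.Ioi (0 : ℝ), (|(-2 : ℝ)| * y ^ ((-2 : ℝ) - 1)) • gaussLimit (y ^ (-2 : ℝ)) =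
      2 * √(3 / (2 * Real.pi)) ^ 3 * Real.exp (-(3 / 2) * y ^ 2) := by
    intro y hy
    have hy0 : (0 : ℝ) < y := hy
    have e1 : y ^ ((-2 : ℝ) - 1) = (y ^ 3)⁻¹ := by
      rw [show (-2 : ℝ) - 1 = -((3 : ℕ) : ℝ) by norm_num, Real.rpow_neg hy0.le, Real.rpow_natCast]
    have e2 : y ^ (-2 : ℝ) = (y ^ 2)⁻¹ := by
      rw [show (-2 : ℝ) = -((2 : ℕ) : ℝ) by norm_num, Real.rpow_neg hy0.le, Real.rpow_natCast]
    have e3 : 2 * Real.pi * ((y ^ 2)⁻¹ / 3) = (2 * Real.pi / 3) / y ^ 2 := by field_simp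
    have e4 : √(3 / (2 * Real.pi)) = (√(2 * Real.pi / 3))⁻¹ := by
      rw [← Real.sqrt_inv, inv_div]
    rw [e1, e2, gaussLimit, e3, Real.sqrt_div (by positivity), Real.sqrt_sq hy0.le, e4,
      smul_eq_mul]
    have e5 : -(1 / (2 * ((y ^ 2)⁻¹ / 3))) = -(3 / 2) * y ^ 2 := by field_simp
    have hs : 0 < √(2 * Real.pi / 3) := Real.sqrt_pos.2 (by positivity)
    rw [e5, abs_neg, abs_of_pos two_pos]
    field_simp
  rw [setIntegral_congr_fun measurableSet_Ioi h, integral_const_mul, integral_gaussian_Ioi]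
  have e6 : √(Real.pi / (3 / 2)) = (√(3 / (2 * Real.pi)))⁻¹ := by
    rw [← Real.sqrt_inv, inv_div]
    congr 1
    field_simp
  have hs : 0 < √(3 / (2 * Real.pi)) := Real.sqrt_pos.2 (by positivity)
  have e7 : √(3 / (2 * Real.pi)) ^ 2 = 3 / (2 * Real.pi) := Real.sq_sqrt (by positivity)
  rw [e6]
  calc _ = √(3 / (2 * Real.pi)) ^ 2 := by field_simp
    _ = _ := e7

lemma measurable_scaledHeat (x : Lattice) : Measurable (scaledHeat x) :=
  Finset.measurable_prod _ fun i _ => ((measurable_heat (x i)).measurable.comp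
    ((measurable_id.div_const 3).const_mul _)).const_mul _

/-- The Green function satisfies `G(x) ∼ 3 / (2π |x|)`. -/
theorem tendsto_euclNorm_mul_green :
    Tendsto (fun x => euclNorm x * green x) (comap euclNorm atTop) (𝓝 (3 / (2 * Real.pi))) := by
  rw [← integral_gaussLimit]
  -- An `x`-independent dominating function: off-diagonal decay for short times, diffusive decay for
  -- long times.
  set bd : ℝ → ℝ := fun s => if s ≤ 1 then 60 * (1 / √(s / 3)) else (1 / √(s / 3)) ^ 3 with hbd
  have hbdi : Integrable bd (volume.restrict (Set.Ioi 0)) := by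
    refine integrableOn_Ioi_of_le_rpow ?_ (C := 60 * √3) (D := √3 ^ 3) ?_ ?_
    · exact Measurable.ite measurableSet_Iic (by fun_prop) (by fun_prop)
    · intro s hs hs1
      rw [hbd]
      simp only [if_pos hs1]
      rw [abs_of_nonneg (by positivity), one_div_sqrt_div_three hs, mul_assoc]
    · intro s hs
      rw [hbd]
      simp only [if_neg hs.not_ge]
      rw [abs_of_nonneg (by positivity), one_div_sqrt_div_three_pow (by linarith)]
  have h := tendsto_integral_filter_of_dominated_convergence
    (μ := volume.restrict (Set.Ioi (0 : ℝ))) (l := comap euclNorm atTop) (F := scaledHeat)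
    (f := gaussLimit) bd ?_ ?_ hbdi ?_
  · refine h.congr' ?_
    filter_upwards [tendsto_comap.eventually (eventually_gt_atTop (0 : ℝ))] with x hx
    exact (euclNorm_mul_green hx).symm
  · exact Eventually.of_forall fun x => (measurable_scaledHeat x).aestronglyMeasurable
  · filter_upwards [tendsto_comap.eventually (eventually_gt_atTop (0 : ℝ))] with x hx
    refine (ae_restrict_iff' measurableSet_Ioi).2 (ae_of_all _ fun s hs => ?_)
    rw [hbd]
    simp only
    split_ifs
    · exact abs_scaledHeat_le' hx hs
    · exact abs_scaledHeat_le hx hs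
  · exact (ae_restrict_iff' measurableSet_Ioi).2 (ae_of_all _ fun s hs => tendsto_scaledHeat hs)

lemma exists_green_bounds {ε : ℝ} (hε : 0 < ε) : ∃ K : ℝ, 0 < K ∧ ∀ x, K ≤ euclNorm x →
    (1 - ε) * (3 / (2 * Real.pi)) ≤ euclNorm x * green x ∧
      euclNorm x * green x ≤ (1 + ε) * (3 / (2 * Real.pi)) := by
  have hpi := Real.pi_pos
  have h0 : 0 < 3 / (2 * Real.pi) := by positivity
  have h := tendsto_euclNorm_mul_green.eventually
    (Icc_mem_nhds (show (1 - ε) * (3 / (2 * Real.pi)) < 3 / (2 * Real.pi) by nlinarith)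
      (show 3 / (2 * Real.pi) < (1 + ε) * (3 / (2 * Real.pi)) by nlinarith))
  rw [eventually_comap] at h
  obtain ⟨K, hK⟩ := eventually_atTop.1 h
  refine ⟨max K 1, by positivity, fun x hx => hK _ ((le_max_left _ _).trans hx) x rfl⟩

lemma green_step_le (x : Lattice) (e : Dir) : (1 / 6) * green (x - step e) ≤ green x := by
  unfold green
  rw [(summable_kern x).tsum_eq_zero_add, ← tsum_mul_left]
  refine le_trans ?_ (le_add_of_nonneg_left (kern_nonneg 0 x))
  refine ((summable_kern (x - step e)).mul_left _).tsum_le_tsum (fun n => ?_)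
    ((summable_nat_add_iff 1).2 (summable_kern x))
  rw [kern]
  refine mul_le_mul_of_nonneg_left ?_ (by norm_num)
  exact Finset.single_le_sum (f := fun e => kern n (x - step e)) (fun _ _ => kern_nonneg _ _)
    (Finset.mem_univ e)

/-- A zero of `green` would propagate to neighbours along a ray to infinity, contradicting the
asymptotics there. -/
lemma green_pos (x : Lattice) : 0 < green x := by
  by_contra hneg
  have h0 : green x = 0 := le_antisymm (not_lt.1 hneg) (green_nonneg x)
  set e : Dir := (0, false)
  have hz : ∀ n : ℕ, green (x - n • step e) = 0 := by
    intro n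
    induction n with
    | zero => simpa using h0
    | succ n ih =>
      have h1 := green_step_le (x - n • step e) e
      rw [ih, sub_sub, ← succ_nsmul] at h1
      have h2 := green_nonneg (x - (n + 1) • step e)
      linarith
  obtain ⟨K, hK0, hK⟩ := exists_green_bounds (show (0 : ℝ) < 1 / 2 by norm_num)
  obtain ⟨n, hn⟩ := exists_nat_ge (K + |(x 0 : ℝ)|)
  have hlarge : K ≤ euclNorm (x - n • step e) := by
    refine le_trans ?_ (abs_coord_le_euclNorm _ 0)
    simp only [e, step, Pi.sub_apply, Pi.smul_apply, Pi.single_eq_same, Bool.false_eq_true, if_false]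
    push_cast
    have h1 := neg_abs_le (x 0 : ℝ)
    refine le_trans ?_ (le_abs_self _)
    simp only [nsmul_eq_mul]
    push_cast
    linarith
  have h1 := (hK _ hlarge).1
  rw [hz n, mul_zero] at h1
  have : 0 < (1 - 1 / 2) * (3 / (2 * Real.pi)) := by have := Real.pi_pos; positivity
  linarith

lemma exists_le_green {ε : ℝ} (hε : 0 < ε) : ∃ K : ℝ, 0 < K ∧ ∀ ρ, K ≤ ρ → ∀ x, euclNorm x ≤ ρ →
    (1 - ε) * (3 / (2 * Real.pi)) / ρ ≤ green x := by
  have hpi := Real.pi_pos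
  have h0 : 0 < 3 / (2 * Real.pi) := by positivity
  obtain ⟨K, hK0, hK⟩ := exists_green_bounds hε
  obtain ⟨c, hc0, hc⟩ : ∃ c : ℝ, 0 < c ∧ ∀ x, euclNorm x ≤ K → c ≤ green x := by
    obtain ⟨y, -, hy⟩ := Set.exists_min_image _ green (finite_euclNorm_le K)
      ⟨0, by simp [euclNorm, hK0.le]⟩
    exact ⟨green y, green_pos y, hy⟩
  -- The second threshold handles the finitely many `x` near 0, where `green` is at least `c`.
  refine ⟨max K (3 / (2 * Real.pi) / c), by positivity, fun ρ hρ x hx => ?_⟩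
  have hρK := (le_max_left _ _).trans hρ
  have hρ0 : 0 < ρ := hK0.trans_le hρK
  rcases le_total (euclNorm x) K with h | h
  · refine le_trans ?_ (hc x h)
    rw [div_le_iff₀ hρ0]
    have h1 := (le_max_right _ _).trans hρ
    rw [div_le_iff₀ hc0] at h1
    nlinarith
  · have h1 := (hK x h).1
    rw [div_le_iff₀ hρ0, mul_comm]
    rw [mul_comm] at h1 ⊢
    have := mul_le_mul_of_nonneg_right hx (green_nonneg x)
    linarith

lemma exists_green_le_div : ∃ C : ℝ, 0 < C ∧ (∀ x, green x ≤ C) ∧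
    ∀ x, x ≠ 0 → green x ≤ C / euclNorm x := by
  obtain ⟨K, hK0, hK⟩ := exists_green_bounds one_pos
  obtain ⟨c, hc⟩ := ((finite_euclNorm_le K).image fun x => green x).bddAbove
  have hpi := Real.pi_pos
  set D := (1 + 1) * (3 / (2 * Real.pi)) with hD
  have hD0 : 0 < D := by positivity
  have hc0 : 0 ≤ c := (green_nonneg 0).trans (hc ⟨0, by simp [euclNorm, hK0.le], rfl⟩)
  have key : ∀ x, x ≠ 0 → green x ≤ (K * c + c + D) / euclNorm x := by
    intro x hx
    have h1 := one_le_euclNorm hx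
    rw [le_div_iff₀ (by linarith), mul_comm]
    rcases le_total (euclNorm x) K with h | h
    · have h2 : green x ≤ c := hc ⟨x, h, rfl⟩
      have := mul_le_mul h h2 (green_nonneg x) hK0.le
      linarith
    · linarith [(hK x h).2, mul_nonneg hK0.le hc0]
  refine ⟨K * c + c + D, by positivity, fun x => ?_, key⟩
  by_cases hx : x = 0
  · have h2 : green x ≤ c := hc ⟨x, by simp [hx, euclNorm, hK0.le], rfl⟩
    linarith [mul_nonneg hK0.le hc0]
  · exact (key x hx).trans (div_le_self (by positivity) (one_le_euclNorm hx))

/-! ### Upper bound for chains of balls. -/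

lemma log_sub_log_two_le_sum (L : ℕ) :
    Real.log (L + 2) - Real.log 2 ≤ ∑ k ∈ Finset.range L, 1 / ((k : ℝ) + 2) := by
  induction L with
  | zero => simp
  | succ L ih =>
    rw [Finset.sum_range_succ]
    have h0 : (0 : ℝ) < L + 2 := by positivity
    have h1 : Real.log ((L + 1 + 2) / (L + 2)) ≤ (L + 1 + 2) / (L + 2) - 1 :=
      Real.log_le_sub_one_of_pos (by positivity)
    rw [Real.log_div (by positivity) (by positivity)] at h1
    have h2 : ((L : ℝ) + 1 + 2) / (L + 2) - 1 = 1 / (L + 2) := by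
      field_simp
      ring
    push_cast
    linarith

/-- A finite chain of points, continued constantly beyond its ends. -/
def extendChain (N : ℕ) (z : ℕ → Lattice) (i : ℤ) : Lattice := z (min i.toNat (N - 1))

lemma extendChain_natCast {N : ℕ} (z : ℕ → Lattice) {j : ℕ} (hj : j < N) :
    extendChain N z j = z j := by
  unfold extendChain
  congr 1
  simp only [Int.toNat_natCast]
  omega

lemma euclNorm_extendChain_sub_le {N : ℕ} {z : ℕ → Lattice} {ρ : ℝ} (hρ : 0 ≤ ρ)
    (hz : ∀ i, i + 1 < N → euclNorm (z (i + 1) - z i) ≤ ρ) (i : ℤ) (k : ℕ) :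
    euclNorm (extendChain N z (i + k) - extendChain N z i) ≤ ρ * k := by
  induction k with
  | zero => simp [euclNorm]
  | succ k ih =>
    have h1 : euclNorm (extendChain N z (i + (k + 1 : ℕ)) - extendChain N z (i + k)) ≤ ρ := by
      unfold extendChain
      rcases eq_or_ne (min (i + (k + 1 : ℕ)).toNat (N - 1)) (min (i + k).toNat (N - 1)) with h | h
      · rw [h]
        simpa [euclNorm] using hρ
      · have h2 : min (i + (k + 1 : ℕ)).toNat (N - 1) = min (i + k).toNat (N - 1) + 1 := by
          omega
        rw [h2]
        exact hz _ (by omega)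
    have h3 := euclNorm_add_le (extendChain N z (i + (k + 1 : ℕ)) - extendChain N z (i + k))
      (extendChain N z (i + k) - extendChain N z i)
    rw [sub_add_sub_cancel] at h3
    push_cast at h1 h3 ⊢
    linarith

lemma sum_two_sided_le {f : ℤ → ℝ} (hf : ∀ i, 0 ≤ f i) (j : ℤ) (L : ℕ) {I : Finset ℤ}
    (hI : Finset.Icc (j - L) (j + L) ⊆ I) {g : ℕ → ℝ}
    (hg : ∀ k < L, g k ≤ f (j + (k + 1 : ℕ)) ∧ g k ≤ f (j - (k + 1 : ℕ))) :
    2 * ∑ k ∈ Finset.range L, g k ≤ ∑ i ∈ I, f i := by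
  set φ : ℕ × Bool → ℤ := fun p => if p.2 then j + (p.1 + 1 : ℕ) else j - (p.1 + 1 : ℕ) with hφ
  set S := Finset.range L ×ˢ (Finset.univ : Finset Bool) with hS
  have hinj : Set.InjOn φ S := by
    rintro ⟨k, b⟩ - ⟨k', b'⟩ - h
    cases b <;> cases b' <;> simp [hφ] at h ⊢ <;> omega
  have hsub : S.image φ ⊆ I := by
    intro i hi
    obtain ⟨⟨k, b⟩, hk, rfl⟩ := Finset.mem_image.1 hi
    apply hI
    have hk' : k < L := by simpa [hS] using hk
    rw [Finset.mem_Icc]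
    cases b <;> simp [hφ] <;> omega
  calc 2 * ∑ k ∈ Finset.range L, g k = ∑ p ∈ S, g p.1 := by
        rw [hS, Finset.sum_product, Finset.mul_sum]
        simp
    _ ≤ ∑ p ∈ S, f (φ p) := by
        refine Finset.sum_le_sum ?_
        rintro ⟨k, b⟩ hk
        have hk' : k < L := by simpa [hS] using hk
        cases b
        · simpa [hφ] using (hg k hk').2
        · simpa [hφ] using (hg k hk').1
    _ = ∑ i ∈ S.image φ, f i := (Finset.sum_image hinj).symm
    _ ≤ ∑ i ∈ I, f i := Finset.sum_le_sum_of_subset_of_nonneg hsub fun i _ _ => hf i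

/-- Equal masses are placed at the chain points, with about δy further copies of each end point.
Every ball then has enough indices on both sides for two full harmonic sums, at a relative cost O(δ)
in total mass. -/
lemma cap_chain_le_of_pos {δ : ℝ} (hδ : 0 < δ) (hδ1 : δ < 1) : ∃ K : ℝ, 1 < K ∧
    ∀ ρ y : ℝ, K ≤ ρ → K ≤ y → ∀ (N : ℕ) (z : ℕ → Lattice) (A : Finset Lattice), (N : ℝ) ≤ y →
      (∀ i, i + 1 < N → euclNorm (z (i + 1) - z i) ≤ ρ) →
      (A : Set Lattice) ⊆ ⋃ i < N, ball (z i) ρ →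
      cap A ≤ Real.pi / 3 * ((1 + 3 * δ) / (1 - δ) ^ 2) * (y * ρ / Real.log y) := by
  have hpi := Real.pi_pos
  have h1δ : 0 < 1 - δ := by linarith
  obtain ⟨K₁, hK₁0, hK₁⟩ := exists_le_green hδ
  -- This threshold makes log(δy) − log 2 ≥ (1 − δ) log y. The condition y ≥ 2/δ below absorbs
  -- rounding, giving 2L ≤ 3δy.
  obtain ⟨K₂, hK₂⟩ := eventually_atTop.1
    (Real.tendsto_log_atTop.eventually (eventually_ge_atTop (Real.log (2 / δ) / δ)))
  refine ⟨max (max K₁ K₂) (max 2 (2 / δ)), lt_of_lt_of_le one_lt_two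
    ((le_max_left _ _).trans (le_max_right _ _)), ?_⟩
  intro ρ y hρ hy N z A hN hz hA
  have hρK : K₁ ≤ ρ := (le_max_left _ _).trans ((le_max_left _ _).trans hρ)
  have hyK : K₂ ≤ y := (le_max_right _ _).trans ((le_max_left _ _).trans hy)
  have hy2 : 2 ≤ y := (le_max_left _ _).trans ((le_max_right _ _).trans hy)
  have hyδ : 2 / δ ≤ y := (le_max_right _ _).trans ((le_max_right _ _).trans hy)
  have hρ0 : 0 < ρ := hK₁0.trans_le hρK
  have hlogy : 0 < Real.log y := Real.log_pos (by linarith)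
  have hlog := hK₂ y hyK
  rw [div_le_iff₀ hδ] at hlog hyδ
  set L : ℕ := ⌈δ * y⌉₊ with hL
  have hL1 : δ * y ≤ L := Nat.le_ceil _
  have hL2 : (L : ℝ) < δ * y + 1 := Nat.ceil_lt_add_one (by positivity)
  -- The weight is chosen so that the lower bound for the potential is exactly 1.
  set c : ℝ := Real.pi * ρ / (3 * (1 - δ) ^ 2 * Real.log y) with hc
  have hc0 : 0 ≤ c := by positivity
  have hsum : (1 - δ) * Real.log y ≤ ∑ k ∈ Finset.range L, 1 / ((k : ℝ) + 2) := by
    refine le_trans ?_ (log_sub_log_two_le_sum L)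
    have h1 : Real.log (δ * y) ≤ Real.log (L + 2) :=
      Real.log_le_log (by positivity) (by linarith)
    rw [Real.log_mul (by positivity) (by positivity)] at h1
    rw [Real.log_div (by positivity) (by positivity)] at hlog
    linarith
  have hpot : ∀ x ∈ A, 1 ≤ c * ∑ i ∈ Finset.Icc (-(L : ℤ)) (N - 1 + L),
      green (x - extendChain N z i) := by
    intro x hx
    obtain ⟨j, hj, hxj⟩ : ∃ j, j < N ∧ x ∈ ball (z j) ρ := by simpa using hA hx
    have hxj' : euclNorm (x - z j) ≤ ρ := hxj
    -- One extra ρ for the distance from `x` to its centre turns k + 1 into k + 2; the term of index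
    -- `j` itself is discarded.
    have hterm : ∀ k : ℕ, ∀ w : Lattice, euclNorm (z j - w) ≤ ρ * (k + 1 : ℕ) →
        (1 - δ) * (3 / (2 * Real.pi)) / ρ * (1 / ((k : ℝ) + 2)) ≤ green (x - w) := by
      intro k w hw
      have h3 := euclNorm_add_le (x - z j) (z j - w)
      rw [sub_add_sub_cancel] at h3
      push_cast at hw
      have h4 := hK₁ (ρ * (k + 2)) (by nlinarith [(Nat.cast_nonneg k : (0 : ℝ) ≤ k)]) (x - w)
        (by linarith)
      rwa [← div_div, div_eq_mul_one_div _ ((k : ℝ) + 2)] at h4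
    have h5 := sum_two_sided_le (f := fun i => green (x - extendChain N z i))
      (fun i => green_nonneg _) j L (I := Finset.Icc (-(L : ℤ)) (N - 1 + L))
      (Finset.Icc_subset_Icc (by omega) (by omega))
      (g := fun k => (1 - δ) * (3 / (2 * Real.pi)) / ρ * (1 / ((k : ℝ) + 2))) fun k _ => by
        constructor
        · apply hterm
          rw [← extendChain_natCast z hj, euclNorm_sub_comm]
          exact euclNorm_extendChain_sub_le hρ0.le hz _ _
        · apply hterm
          rw [← extendChain_natCast z hj]
          have := euclNorm_extendChain_sub_le hρ0.le hz ((j : ℤ) - (k + 1 : ℕ)) (k + 1)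
          rwa [sub_add_cancel] at this
    rw [← Finset.mul_sum] at h5
    calc (1 : ℝ) = c * (2 * ((1 - δ) * (3 / (2 * Real.pi)) / ρ * ((1 - δ) * Real.log y))) := by
          rw [hc]; field_simp
      _ ≤ c * (2 * ((1 - δ) * (3 / (2 * Real.pi)) / ρ *
          ∑ k ∈ Finset.range L, 1 / ((k : ℝ) + 2))) := by gcongr
      _ ≤ _ := by gcongr
  have hcap := cap_le_of_one_le_potential summable_kern A _ _ hc0 hpot
  refine hcap.trans ?_
  have hcard : ((Finset.Icc (-(L : ℤ)) (N - 1 + L)).card : ℝ) ≤ (1 + 3 * δ) * y := by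
    rw [Int.card_Icc, show ((N : ℤ) - 1 + L + 1 - -(L : ℤ)).toNat = N + 2 * L by omega]
    push_cast
    linarith
  calc c * ((Finset.Icc (-(L : ℤ)) (N - 1 + L)).card : ℝ) ≤ c * ((1 + 3 * δ) * y) := by gcongr
    _ = _ := by rw [hc]; field_simp

/-- The capacity of a chain of `y` balls of radius `ρ` is asymptotically at most
`(π / 3) y ρ / log y`. -/
lemma cap_chain_le {ε : ℝ} (hε : 0 < ε) : ∃ K : ℝ, 1 < K ∧
    ∀ ρ y : ℝ, K ≤ ρ → K ≤ y → ∀ (N : ℕ) (z : ℕ → Lattice) (A : Finset Lattice), (N : ℝ) ≤ y →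
      (∀ i, i + 1 < N → euclNorm (z (i + 1) - z i) ≤ ρ) →
      (A : Set Lattice) ⊆ ⋃ i < N, ball (z i) ρ →
      cap A ≤ (Real.pi / 3 + ε) * (y * ρ / Real.log y) := by
  have hcont : ContinuousAt (fun δ : ℝ => Real.pi / 3 * ((1 + 3 * δ) / (1 - δ) ^ 2)) 0 := by
    refine continuousAt_const.mul (ContinuousAt.div (by fun_prop) (by fun_prop) (by norm_num))
  have h1 : ∀ᶠ δ in 𝓝[>] (0 : ℝ), Real.pi / 3 * ((1 + 3 * δ) / (1 - δ) ^ 2) < Real.pi / 3 + ε :=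
    (hcont.tendsto.mono_left nhdsWithin_le_nhds).eventually (gt_mem_nhds (by simpa using hε))
  obtain ⟨δ, hδε, hδ0, hδ1⟩ := (h1.and (Ioo_mem_nhdsGT one_pos)).exists
  obtain ⟨K, hK1, hK⟩ := cap_chain_le_of_pos hδ0 hδ1
  refine ⟨K, hK1, fun ρ y hρ hy N z A hN hz hA => (hK ρ y hρ hy N z A hN hz hA).trans ?_⟩
  have hlog : 0 < Real.log y := Real.log_pos (by linarith)
  have hρ0 : 0 < ρ := by linarith
  have hy0 : 0 < y := by linarith
  gcongr

/-! ### Lower bound for sets containing a sparse cylinder. -/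

lemma sum_natAbs_le {s : Finset ℤ} {T : Finset ℕ} (hsT : ∀ i ∈ s, i.natAbs ∈ T) {f : ℕ → ℝ}
    (hf : ∀ j, 0 ≤ f j) : ∑ i ∈ s, f i.natAbs ≤ 2 * ∑ j ∈ T, f j := by
  rw [← Finset.sum_fiberwise_of_maps_to hsT, Finset.mul_sum]
  refine Finset.sum_le_sum fun j _ => ?_
  have hcard : (s.filter fun i => i.natAbs = j).card ≤ 2 := by
    refine (Finset.card_le_card (t := {(j : ℤ), -(j : ℤ)}) fun i hi => ?_).trans
      Finset.card_le_two
    have := (Finset.mem_filter.1 hi).2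
    simp only [Finset.mem_insert, Finset.mem_singleton]
    omega
  calc ∑ i ∈ s with i.natAbs = j, f i.natAbs = ∑ i ∈ s with i.natAbs = j, f j :=
        Finset.sum_congr rfl fun i hi => by rw [(Finset.mem_filter.1 hi).2]
    _ = ((s.filter fun i => i.natAbs = j).card : ℝ) * f j := by simp
    _ ≤ 2 * f j := by
        gcongr
        · exact hf j
        · exact_mod_cast hcard

lemma sum_one_div_sqrt_le (n : ℕ) :
    ∑ j ∈ Finset.range n, 1 / √(1 + (j : ℝ)) ≤ 2 * √n := by
  induction n with
  | zero => simp
  | succ n ih =>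
    rw [Finset.sum_range_succ]
    push_cast
    have h1 : √(n : ℝ) ≤ √(n + 1 : ℝ) := Real.sqrt_le_sqrt (by linarith)
    have h2 : √(n : ℝ) ^ 2 = n := Real.sq_sqrt (by positivity)
    have h3 : √(n + 1 : ℝ) ^ 2 = n + 1 := Real.sq_sqrt (by positivity)
    have h4 : 0 < √(n + 1 : ℝ) := Real.sqrt_pos.2 (by positivity)
    have h5 : 1 / √(1 + (n : ℝ)) ≤ 2 * √(n + 1 : ℝ) - 2 * √(n : ℝ) := by
      rw [add_comm, div_le_iff₀ h4]
      nlinarith [sq_nonneg (√(n + 1 : ℝ) - √(n : ℝ))]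
    linarith

lemma sum_Ioc_one_div_le {q M : ℕ} (hq : 1 ≤ q) (hM : q ≤ M) :
    ∑ j ∈ Finset.Ioc q M, 1 / (j : ℝ) ≤ Real.log M - Real.log q := by
  induction M, hM using Nat.le_induction with
  | base => simp
  | succ M hM ih =>
    rw [Finset.sum_Ioc_succ_top (by omega)]
    have h0 : (0 : ℝ) < M := by exact_mod_cast (by omega : 0 < M)
    have h1 : Real.log (M / (M + 1)) ≤ M / (M + 1) - 1 :=
      Real.log_le_sub_one_of_pos (by positivity)
    rw [Real.log_div (by positivity) (by positivity)] at h1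
    have h2 : (M : ℝ) / (M + 1) - 1 = -(1 / (M + 1)) := by
      field_simp
      ring
    push_cast
    linarith

lemma euclNorm_nsmul (l : ℕ) (w : Lattice) : euclNorm (l • w) = l * euclNorm w := by
  have h : ∀ i, (((l • w) i : ℤ) : ℝ) ^ 2 = (l : ℝ) ^ 2 * (w i : ℝ) ^ 2 := fun i => by
    simp [mul_pow]
  rw [euclNorm, euclNorm, Finset.sum_congr rfl fun i _ => h i, ← Finset.mul_sum,
    Real.sqrt_mul (by positivity), Real.sqrt_sq (by positivity)]

/-- Splitting 1/|w| into one-coordinate factors makes its sum over a cube factorize, with the right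
order q² and no geometry. -/
lemma one_div_euclNorm_le {w : Lattice} (hw : w ≠ 0) :
    1 / euclNorm w ≤ 2 * (1 / √(1 + ((w 0).natAbs : ℝ)) * (1 / √(1 + ((w 1).natAbs : ℝ)))) := by
  have h1 := one_le_euclNorm hw
  have hb : ∀ i, 1 + ((w i).natAbs : ℝ) ≤ 2 * euclNorm w := fun i => by
    have := abs_coord_le_euclNorm w i
    rw [Nat.cast_natAbs, Int.cast_abs]
    linarith
  have hp : ∀ i, 0 < √(1 + ((w i).natAbs : ℝ)) := fun i => Real.sqrt_pos.2 (by positivity)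
  have h2 : √(1 + ((w 0).natAbs : ℝ)) * √(1 + ((w 1).natAbs : ℝ)) ≤ 2 * euclNorm w := by
    calc _ ≤ √(2 * euclNorm w) * √(2 * euclNorm w) := by gcongr <;> exact hb _
      _ = 2 * euclNorm w := Real.mul_self_sqrt (by linarith)
  rw [div_mul_div_comm, one_mul, mul_one_div, div_le_div_iff₀ (by linarith) (mul_pos (hp 0) (hp 1))]
  linarith

lemma sum_cube_green_nsmul_le {C : ℝ} (hC : 0 < C) (hC1 : ∀ x, green x ≤ C)
    (hC2 : ∀ x, x ≠ 0 → green x ≤ C / euclNorm x) {l q : ℕ} (hl : 1 ≤ l) (hq : 1 ≤ q) :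
    ∑ w ∈ Fintype.piFinset (fun _ : Fin 3 => Finset.Icc (-(q : ℤ)) q), green (l • w) ≤
      C + 192 * C * (q ^ 2 / l) := by
  have hl0 : (0 : ℝ) < l := by exact_mod_cast hl
  have hq1 : (1 : ℝ) ≤ q := by exact_mod_cast hq
  set Q := Fintype.piFinset (fun _ : Fin 3 => Finset.Icc (-(q : ℤ)) q) with hQ
  set s : ℤ → ℝ := fun i => 1 / √(1 + (i.natAbs : ℝ)) with hs
  have hs0 : ∀ i, 0 ≤ s i := fun i => by positivity
  have hpt : ∀ w ∈ Q, green (l • w) ≤ (if w = 0 then C else 0) + 2 * C / l * (s (w 0) * s (w 1)) := by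
    intro w _
    split_ifs with h
    · have : 0 ≤ 2 * C / l * (s (w 0) * s (w 1)) :=
        mul_nonneg (by positivity) (mul_nonneg (hs0 _) (hs0 _))
      linarith [hC1 (l • w)]
    · have hne : l • w ≠ 0 := smul_ne_zero (by omega) h
      rw [zero_add]
      refine (hC2 _ hne).trans ?_
      rw [euclNorm_nsmul]
      calc C / (l * euclNorm w) = C / l * (1 / euclNorm w) := by rw [div_mul_div_comm, mul_one]
        _ ≤ C / l * (2 * (s (w 0) * s (w 1))) := by
            gcongr
            exact one_div_euclNorm_le h
        _ = _ := by ring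
  have hS : ∑ i ∈ Finset.Icc (-(q : ℤ)) q, s i ≤ 4 * √(q + 1 : ℝ) := by
    have h1 := sum_natAbs_le (s := Finset.Icc (-(q : ℤ)) q) (T := Finset.range (q + 1))
      (fun i hi => by
        rw [Finset.mem_Icc] at hi
        rw [Finset.mem_range]
        omega) (f := fun j => 1 / √(1 + (j : ℝ))) fun j => by positivity
    have h2 := sum_one_div_sqrt_le (q + 1)
    push_cast at h2
    linarith
  have hprod : ∑ w ∈ Q, s (w 0) * s (w 1) =
      (∑ i ∈ Finset.Icc (-(q : ℤ)) q, s i) ^ 2 * (2 * q + 1) := by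
    have h := Finset.prod_univ_sum (fun _ : Fin 3 => Finset.Icc (-(q : ℤ)) q)
      (![s, s, fun _ => 1] : Fin 3 → ℤ → ℝ)
    simp only [Fin.prod_univ_three] at h
    simp only [Matrix.cons_val_zero, Matrix.cons_val_one, Matrix.cons_val, mul_one,
      Finset.sum_const, Int.card_Icc, nsmul_eq_mul] at h
    rw [← h, show ((q : ℤ) + 1 - -(q : ℤ)).toNat = 2 * q + 1 by omega]
    push_cast
    ring
  have hS0 : 0 ≤ ∑ i ∈ Finset.Icc (-(q : ℤ)) q, s i := Finset.sum_nonneg fun i _ => hs0 i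
  calc ∑ w ∈ Q, green (l • w)
      ≤ ∑ w ∈ Q, ((if w = 0 then C else 0) + 2 * C / l * (s (w 0) * s (w 1))) :=
        Finset.sum_le_sum hpt
    _ = (∑ w ∈ Q, if w = 0 then C else 0) + 2 * C / l * ∑ w ∈ Q, s (w 0) * s (w 1) := by
        rw [Finset.sum_add_distrib, Finset.mul_sum]
    _ ≤ C + 2 * C / l * ((4 * √(q + 1 : ℝ)) ^ 2 * (2 * q + 1)) := by
        rw [hprod]
        gcongr
        rw [Finset.sum_ite_eq']
        split_ifs <;> linarith
    -- Here 16(q + 1)(2q + 1) ≤ 96q², as q ≥ 1.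
    _ ≤ C + 2 * C / l * (96 * q ^ 2) := by
        refine add_le_add le_rfl (mul_le_mul_of_nonneg_left ?_ (by positivity))
        rw [mul_pow, Real.sq_sqrt (by positivity)]
        nlinarith
    _ = _ := by ring

/-- The lattice box `[0, q)² × [1, M]`. -/
def box (q M : ℕ) : Finset Lattice :=
  Fintype.piFinset ![Finset.Ico 0 (q : ℤ), Finset.Ico 0 (q : ℤ), Finset.Icc 1 (M : ℤ)]

lemma mem_box {q M : ℕ} {w : Lattice} : w ∈ box q M ↔
    (0 ≤ w 0 ∧ w 0 < q) ∧ (0 ≤ w 1 ∧ w 1 < q) ∧ (1 ≤ w 2 ∧ w 2 ≤ M) := by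
  rw [box, Fintype.mem_piFinset, Fin.forall_fin_succ, Fin.forall_fin_succ, Fin.forall_fin_succ]
  simp

lemma card_box (q M : ℕ) : (box q M).card = q ^ 2 * M := by
  rw [box, Fintype.card_piFinset, Fin.prod_univ_three]
  simp [sq]

lemma sum_box_coord_two (q M : ℕ) (F : ℤ → ℝ) :
    ∑ w ∈ box q M, F (w 2) = (q : ℝ) ^ 2 * ∑ k ∈ Finset.Icc 1 (M : ℤ), F k := by
  have h := Finset.prod_univ_sum
    ![Finset.Ico 0 (q : ℤ), Finset.Ico 0 (q : ℤ), Finset.Icc 1 (M : ℤ)]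
    (![fun _ => 1, fun _ => 1, F] : Fin 3 → ℤ → ℝ)
  simp only [Fin.prod_univ_three] at h
  simp only [Matrix.cons_val_zero, Matrix.cons_val_one, Matrix.cons_val, one_mul,
    Finset.sum_const, Int.card_Ico, nsmul_eq_mul, sub_zero, Int.toNat_natCast, mul_one] at h
  rw [box, ← h]
  ring

/-- Split by height difference. Up to `q`, differences lie in a cube, whose contribution is O(1 +
q²/l). Beyond `q`, the height alone bounds the distance below, and each of the q² columns
contributes a two-sided harmonic sum. -/
lemma sum_box_green_le {ε K : ℝ} (hε : 0 < ε) (hK : ∀ x, K ≤ euclNorm x →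
      euclNorm x * green x ≤ (1 + ε) * (3 / (2 * Real.pi)))
    {C : ℝ} (hC : 0 < C) (hC1 : ∀ x, green x ≤ C)
    (hC2 : ∀ x, x ≠ 0 → green x ≤ C / euclNorm x) {l q M : ℕ} (hl : 1 ≤ l) (hq : 1 ≤ q)
    (hKq : K ≤ l * q) {w₀ : Lattice} (hw₀ : w₀ ∈ box q M) :
    ∑ w ∈ box q M, green (l • w - l • w₀) ≤ C + 192 * C * (q ^ 2 / l) +
      q ^ 2 / l * ((1 + ε) * (3 / Real.pi) * ∑ j ∈ Finset.Ioc q M, 1 / (j : ℝ)) := by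
  have hpi := Real.pi_pos
  have hl0 : (0 : ℝ) < l := by exact_mod_cast hl
  rw [← Finset.sum_filter_add_sum_filter_not (box q M) fun w => (w 2 - w₀ 2).natAbs ≤ q]
  refine add_le_add ?_ ?_
  · refine le_trans ?_ (sum_cube_green_nsmul_le hC hC1 hC2 hl hq)
    have hinj : Set.InjOn (fun w : Lattice => w - w₀)
        (((box q M).filter fun w => (w 2 - w₀ 2).natAbs ≤ q : Finset Lattice) : Set Lattice) :=
      fun a _ b _ h => sub_left_injective h
    simp_rw [← smul_sub]
    rw [← Finset.sum_image (f := fun w => green (l • w)) hinj]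
    refine Finset.sum_le_sum_of_subset_of_nonneg (fun w hw => ?_) fun w _ _ => green_nonneg _
    obtain ⟨w', hw', rfl⟩ := Finset.mem_image.1 hw
    obtain ⟨hb, hn⟩ := Finset.mem_filter.1 hw'
    rw [mem_box] at hb hw₀
    rw [Fintype.mem_piFinset]
    intro i
    rw [Finset.mem_Icc]
    fin_cases i <;> simp <;> omega
  · set F : ℤ → ℝ := fun k => if (k - w₀ 2).natAbs ≤ q then 0 else
      (1 + ε) * (3 / (2 * Real.pi)) / l * (1 / ((k - w₀ 2).natAbs : ℝ)) with hF
    have hF0 : ∀ k, 0 ≤ F k := fun k => by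
      simp only [hF]
      split_ifs <;> positivity
    have h1 : ∀ w ∈ (box q M).filter fun w => ¬ (w 2 - w₀ 2).natAbs ≤ q,
        green (l • w - l • w₀) ≤ F (w 2) := by
      intro w hw
      have hn := (Finset.mem_filter.1 hw).2
      simp only [hF, if_neg hn]
      rw [← smul_sub]
      have h2 := abs_coord_le_euclNorm (w - w₀) 2
      rw [← Int.cast_abs, ← Nat.cast_natAbs, Pi.sub_apply] at h2
      set j := (w 2 - w₀ 2).natAbs
      have hj : (q : ℝ) ≤ j := by exact_mod_cast (not_le.1 hn).le
      have hj0 : (0 : ℝ) < j := lt_of_lt_of_le (by exact_mod_cast hq) hj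
      have h3 : l * (j : ℝ) ≤ euclNorm (l • (w - w₀)) := by
        rw [euclNorm_nsmul]
        gcongr
      have h4 := hK (l • (w - w₀)) (hKq.trans (le_trans (by gcongr) h3))
      rw [div_mul_div_comm, mul_one, le_div_iff₀ (by positivity), mul_comm]
      exact (mul_le_mul_of_nonneg_right h3 (green_nonneg _)).trans h4
    calc _ ≤ ∑ w ∈ (box q M).filter fun w => ¬ (w 2 - w₀ 2).natAbs ≤ q, F (w 2) :=
          Finset.sum_le_sum h1
      _ ≤ ∑ w ∈ box q M, F (w 2) :=
          Finset.sum_le_sum_of_subset_of_nonneg (Finset.filter_subset _ _) fun w _ _ => hF0 _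
      _ = (q : ℝ) ^ 2 * ∑ k ∈ Finset.Icc 1 (M : ℤ), F k := sum_box_coord_two q M F
      _ ≤ (q : ℝ) ^ 2 * ((1 + ε) * (3 / (2 * Real.pi)) / l *
            (2 * ∑ j ∈ Finset.Ioc q M, 1 / (j : ℝ))) := by
          gcongr
          set S := (Finset.Icc 1 (M : ℤ)).filter fun k => ¬ (k - w₀ 2).natAbs ≤ q with hS
          have h5 : ∑ k ∈ Finset.Icc 1 (M : ℤ), F k = (1 + ε) * (3 / (2 * Real.pi)) / l *
              ∑ k ∈ S, 1 / ((k - w₀ 2).natAbs : ℝ) := by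
            rw [Finset.mul_sum, hS, Finset.sum_filter]
            refine Finset.sum_congr rfl fun k _ => ?_
            simp only [hF, ite_not]
          have hinj : Set.InjOn (fun k : ℤ => k - w₀ 2) (S : Set ℤ) :=
            fun a _ b _ h => sub_left_injective h
          rw [h5, ← Finset.sum_image (f := fun k : ℤ => 1 / (k.natAbs : ℝ)) hinj]
          gcongr
          refine sum_natAbs_le (f := fun j : ℕ => 1 / (j : ℝ)) (fun i hi => ?_)
            fun j => by positivity
          obtain ⟨k, hk, rfl⟩ := Finset.mem_image.1 hi
          obtain ⟨hk1, hk2⟩ := Finset.mem_filter.1 hk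
          rw [Finset.mem_Icc] at hk1
          rw [mem_box] at hw₀
          rw [Finset.mem_Ioc]
          omega
      _ = _ := by ring

/-- A lower bound for the capacity of sets containing a sparse cylinder. -/
lemma exists_le_cap_of_cylinder_subset {ε : ℝ} (hε : 0 < ε) : ∃ K D : ℝ, 0 < K ∧ 0 < D ∧
    ∀ (m r : ℝ) (l : ℕ) (A : Finset Lattice), 1 ≤ l → (l : ℝ) ^ 3 ≤ r ^ 2 → K ≤ r → r ≤ m →
      cylinder m l r ⊆ (A : Set Lattice) →
      (m - l) / ((1 + ε) * (3 / Real.pi) * Real.log (m / r) + D) ≤ cap A := by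
  have hpi := Real.pi_pos
  obtain ⟨K, hK0, hK⟩ := exists_green_bounds hε
  obtain ⟨C, hC, hC1, hC2⟩ := exists_green_le_div
  -- In `D`, log 2 comes from M/q ≤ 2m/r, and 196 = 192 + 4 combines the near cube with the
  -- self-interaction. The factor 2 in `2 * K` gives l q ≥ K.
  refine ⟨2 * K, (1 + ε) * (3 / Real.pi) * Real.log 2 + 196 * C, by positivity, by positivity, ?_⟩
  intro m r l A hl hlr hKr hrm hA
  have hl0 : (0 : ℝ) < l := by exact_mod_cast hl
  have hr0 : 0 < r := by linarith
  have hm0 : 0 < m := by linarith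
  set q : ℕ := ⌊r / (2 * l)⌋₊ + 1 with hq
  set M : ℕ := ⌊m / l⌋₊ with hM
  have hq1 : 1 ≤ q := by omega
  have hq0 : (0 : ℝ) < q := by exact_mod_cast hq1
  -- The side of the box is comparable to `r`, yet (q − 1) l ≤ r/2, so its cross-section fits in the
  -- disc.
  have hqr : r ≤ 2 * (l * q) := by
    have := Nat.lt_floor_add_one (r / (2 * l))
    rw [div_lt_iff₀ (by positivity)] at this
    rw [hq]
    push_cast
    linarith
  have hqr' : ((q : ℝ) - 1) * l ≤ r / 2 := by
    have := Nat.floor_le (show 0 ≤ r / (2 * l) by positivity)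
    rw [le_div_iff₀ (by positivity)] at this
    rw [hq]
    push_cast
    linarith
  have hMm : (M : ℝ) * l ≤ m := (le_div_iff₀ hl0).1 (Nat.floor_le (by positivity))
  have hMm' : m - l ≤ M * l := by
    have := (div_lt_iff₀ hl0).1 (Nat.lt_floor_add_one (m / l))
    linarith
  have hlog : 0 ≤ Real.log (m / r) := Real.log_nonneg ((one_le_div hr0).2 hrm)
  have hlog2 : 0 < Real.log 2 := Real.log_pos one_lt_two
  set V : ℝ := (1 + ε) * (3 / Real.pi) * Real.log (m / r) +
    ((1 + ε) * (3 / Real.pi) * Real.log 2 + 196 * C) with hV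
  have hV0 : 0 < V := by positivity
  have hU0 : 0 < (q : ℝ) ^ 2 / l * V := by positivity
  have hsum : ∑ j ∈ Finset.Ioc q M, 1 / (j : ℝ) ≤ Real.log (m / r) + Real.log 2 := by
    rcases le_total q M with h | h
    · refine (sum_Ioc_one_div_le hq1 h).trans ?_
      have hM0 : (0 : ℝ) < M := lt_of_lt_of_le hq0 (by exact_mod_cast h)
      rw [← Real.log_div hM0.ne' hq0.ne', ← Real.log_mul (by positivity) two_ne_zero]
      refine Real.log_le_log (by positivity) ?_
      rw [div_mul_eq_mul_div, div_le_div_iff₀ hq0 hr0]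
      calc (M : ℝ) * r ≤ M * (2 * (l * q)) := by gcongr
        _ = M * l * 2 * q := by ring
        _ ≤ m * 2 * q := by gcongr
    · rw [Finset.Ioc_eq_empty (by omega), Finset.sum_empty]
      positivity
  -- The exponent 2/3 enters here: l³ ≤ r² makes q²/l bounded below, so the self-interaction `C` is
  -- at most 4C q²/l.
  have hlq : (l : ℝ) ≤ 4 * q ^ 2 := by
    have h1 : (l : ℝ) ^ 3 ≤ (2 * (l * q)) ^ 2 := hlr.trans (by gcongr)
    have h2 : (l : ℝ) ^ 2 * l ≤ l ^ 2 * (4 * q ^ 2) := by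
      calc (l : ℝ) ^ 2 * l = l ^ 3 := by ring
        _ ≤ _ := h1
        _ = _ := by ring
    exact le_of_mul_le_mul_left h2 (by positivity)
  have hinj : Function.Injective fun w : Lattice => l • w := fun a b h => by
    ext i
    have := congrFun h i
    simp only [Pi.smul_apply, nsmul_eq_mul] at this
    exact mul_left_cancel₀ (by exact_mod_cast hl0.ne') this
  set B : Finset Lattice := (box q M).image fun w => l • w with hB
  have hcardB : (B.card : ℝ) = q ^ 2 * M := by
    rw [hB, Finset.card_image_of_injective _ hinj, card_box]
    push_cast
    rfl
  have hBA : B ⊆ A := by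
    intro x hx
    obtain ⟨w, hw, rfl⟩ := Finset.mem_image.1 hx
    obtain ⟨⟨h1, h2⟩, ⟨h3, h4⟩, h5, h6⟩ := mem_box.1 hw
    apply hA
    have key : ∀ k : ℤ, 0 ≤ k → k < q → ((l : ℝ) * k) ^ 2 ≤ (r / 2) ^ 2 := by
      intro k hk0 hkq
      have e1 : (0 : ℝ) ≤ k := by exact_mod_cast hk0
      have e2 : (k : ℝ) ≤ q - 1 := by
        have : k ≤ (q : ℤ) - 1 := by omega
        exact_mod_cast this
      have e3 : (l : ℝ) * k ≤ r / 2 := by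
        calc (l : ℝ) * k ≤ l * (q - 1) := by gcongr
          _ ≤ r / 2 := by linarith
      gcongr
    refine ⟨fun i => ⟨w i, by simp⟩, ?_, ?_, ?_⟩
    · have e1 := key _ h1 h2
      have e2 := key _ h3 h4
      simp only [Pi.smul_apply, nsmul_eq_mul]
      push_cast
      nlinarith [sq_nonneg r]
    · simp only [Pi.smul_apply, nsmul_eq_mul]
      have : (1 : ℤ) ≤ l := by exact_mod_cast hl
      nlinarith
    · simp only [Pi.smul_apply, nsmul_eq_mul]
      push_cast
      have : (w 2 : ℝ) ≤ M := by exact_mod_cast h6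
      calc (l : ℝ) * w 2 ≤ l * M := by gcongr
        _ ≤ m := by linarith
  have hpot : ∀ x ∈ B, ∑ y ∈ B, green (y - x) ≤ (q : ℝ) ^ 2 / l * V := by
    intro x hx
    obtain ⟨w₀, hw₀, rfl⟩ := Finset.mem_image.1 hx
    rw [hB, Finset.sum_image hinj.injOn]
    refine (sum_box_green_le hε (fun x hx => (hK x hx).2) hC hC1 hC2 hl hq1 (by linarith)
      hw₀).trans ?_
    have h1 : C ≤ 4 * C * (q ^ 2 / l) := by
      have : 1 ≤ 4 * (q : ℝ) ^ 2 / l := (one_le_div hl0).2 hlq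
      calc C = C * 1 := by ring
        _ ≤ C * (4 * (q : ℝ) ^ 2 / l) := by gcongr
        _ = _ := by ring
    calc _ ≤ 4 * C * ((q : ℝ) ^ 2 / l) + 192 * C * (q ^ 2 / l) +
          q ^ 2 / l * ((1 + ε) * (3 / Real.pi) * (Real.log (m / r) + Real.log 2)) := by gcongr
      _ = _ := by rw [hV]; ring
  refine le_trans ?_ (le_cap_of_potential_le summable_kern hBA hU0 hpot)
  -- The density cancels: q²M points against a potential (q²/l)V leave Ml/V, and Ml ≥ m − l.
  rw [hcardB, div_le_div_iff₀ hV0 hU0]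
  calc (m - l) * ((q : ℝ) ^ 2 / l * V) ≤ (M * l) * ((q : ℝ) ^ 2 / l * V) := by gcongr
    _ = _ := by field_simp

end SRW3

end

namespace SRW3

/-! ### Cylinders as chains of balls, and passage to the limit. -/

lemma tendsto_div_atTop_of_isLittleO {r : ℝ → ℝ} (hr_top : Tendsto r atTop atTop)
    (hr_o : r =o[atTop] fun m : ℝ => m) : Tendsto (fun m => m / r m) atTop atTop := by
  have h : Tendsto (fun m => r m / m) atTop (𝓝[>] 0) := by
    refine tendsto_nhdsWithin_iff.2 ⟨hr_o.tendsto_div_nhds_zero, ?_⟩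
    filter_upwards [hr_top.eventually_gt_atTop 0, eventually_gt_atTop 0] with m h1 h2
    exact div_pos h1 h2
  refine h.inv_tendsto_nhdsGT_zero.congr fun m => ?_
  simp

lemma tendsto_log_ratio : Tendsto (fun u : ℝ => u / (u - Real.log 2)) atTop (𝓝 1) := by
  have h1 : Tendsto (fun u : ℝ => 1 - Real.log 2 / u) atTop (𝓝 (1 - 0)) :=
    tendsto_const_nhds.sub (tendsto_const_nhds.div_atTop tendsto_id)
  rw [sub_zero] at h1
  have h2 := h1.inv₀ one_ne_zero
  rw [inv_one] at h2
  refine h2.congr' ?_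
  filter_upwards [eventually_gt_atTop 0] with u hu
  rw [one_sub_div hu.ne', inv_div]

/-- A cylinder of radius `r` and height `m` is covered by a chain of balls of radius `2 r`. -/
lemma cylinder_subset_iUnion_ball {m r : ℝ} (hr : 1 ≤ r) :
    cylinder m 1 r ⊆ ⋃ i < ⌊m / (⌊2 * r⌋₊ : ℝ) + 1 / 2⌋₊ + 1,
      ball (fun k => if k = 2 then (⌊2 * r⌋₊ * i : ℤ) else 0) (2 * r) := by
  rintro x ⟨-, hx, hx1, hxm⟩
  set s : ℕ := ⌊2 * r⌋₊ with hs
  have hs0 : 0 < s := Nat.floor_pos.2 (by linarith)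
  have hs0' : (0 : ℝ) < s := by exact_mod_cast hs0
  have hsr : (s : ℝ) ≤ 2 * r := Nat.floor_le (by linarith)
  have hx0 : (0 : ℝ) ≤ x 2 := by exact_mod_cast (by omega : (0 : ℤ) ≤ x 2)
  -- Rounding the height to the nearest multiple of `s` gives an error at most s/2 ≤ r, hence
  -- distance at most √2 r from the centre.
  set i : ℕ := ⌊(x 2 : ℝ) / s + 1 / 2⌋₊ with hi
  have hi1 : (i : ℝ) ≤ (x 2 : ℝ) / s + 1 / 2 := Nat.floor_le (by positivity)
  have hi2 : (x 2 : ℝ) / s + 1 / 2 < i + 1 := Nat.lt_floor_add_one _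
  have hmem : i < ⌊m / (s : ℝ) + 1 / 2⌋₊ + 1 := by
    rw [Nat.lt_succ_iff]
    refine Nat.floor_le_floor ?_
    gcongr
  refine Set.mem_iUnion₂.2 ⟨i, hmem, ?_⟩
  have h1 : |(x 2 : ℝ) - s * i| ≤ r := by
    have e1 : (x 2 : ℝ) / s * s = x 2 := by field_simp
    rw [abs_le]
    constructor <;> nlinarith
  have h2 := sq_le_sq' (abs_le.1 h1).1 (abs_le.1 h1).2
  refine Real.sqrt_le_iff.2 ⟨by linarith, ?_⟩
  rw [Fin.sum_univ_three]
  have e0 : ¬ ((0 : Fin 3) = 2) := by decide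
  have e1 : ¬ ((1 : Fin 3) = 2) := by decide
  simp only [Pi.sub_apply, if_neg e0, if_neg e1, if_true, sub_zero]
  push_cast
  nlinarith [sq_nonneg r]

/-- The capacity of subsets of a cylinder of radius `r` and height `m`, in terms of the capacity
of chains of balls. -/
lemma exists_cap_le_of_subset_cylinder {ε : ℝ} (hε : 0 < ε) : ∃ K : ℝ, 1 < K ∧
    ∀ (m r : ℝ) (A : Finset Lattice), K ≤ r → K ≤ m / (2 * r) →
      (A : Set Lattice) ⊆ cylinder m 1 r →
      cap A ≤ (Real.pi / 3 + ε) * (m * (1 + 1 / (2 * r - 1) + 3 * (r / m)) /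
        (Real.log (m / r) - Real.log 2)) := by
  have hpi := Real.pi_pos
  obtain ⟨K, hK1, hK⟩ := cap_chain_le hε
  refine ⟨K, hK1, fun m r A hr hmr hA => ?_⟩
  have hr0 : 1 < r := by linarith
  have hm0 : 0 < m := by
    by_contra h
    have := div_nonpos_of_nonpos_of_nonneg (not_lt.1 h) (by linarith : 0 ≤ 2 * r)
    linarith
  set s : ℕ := ⌊2 * r⌋₊ with hs
  have hsr : (s : ℝ) ≤ 2 * r := Nat.floor_le (by linarith)
  have hsr' : 2 * r - 1 < s := by linarith [Nat.lt_floor_add_one (2 * r)]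
  have hs0 : (0 : ℝ) < s := by linarith
  -- `y` bounds the number of balls. Their spacing `s` is essentially the full radius 2r, so y · 2r
  -- ∼ m with no constant lost.
  set y : ℝ := m / s + 3 / 2 with hy
  have hy1 : m / (2 * r) ≤ y := by
    have : m / (2 * r) ≤ m / s := by gcongr
    linarith
  have h := hK (2 * r) y (by linarith) (hmr.trans hy1) (⌊m / (s : ℝ) + 1 / 2⌋₊ + 1)
    (fun i k => if k = 2 then (s * i : ℤ) else 0) A (by
      have := Nat.floor_le (show 0 ≤ m / (s : ℝ) + 1 / 2 by positivity)
      push_cast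
      linarith) (fun i _ => by
      refine Real.sqrt_le_iff.2 ⟨by linarith, ?_⟩
      rw [Fin.sum_univ_three]
      have e0 : ¬ ((0 : Fin 3) = 2) := by decide
      have e1 : ¬ ((1 : Fin 3) = 2) := by decide
      simp only [Pi.sub_apply, if_neg e0, if_neg e1, if_true, sub_zero]
      push_cast
      nlinarith) (hA.trans (cylinder_subset_iUnion_ball hr0.le))
  refine h.trans ?_
  have hlog : Real.log (m / r) - Real.log 2 = Real.log (m / (2 * r)) := by
    rw [← Real.log_div (by positivity) two_ne_zero, div_div, mul_comm r 2]
  have hlogpos : 0 < Real.log (m / (2 * r)) := Real.log_pos (by linarith)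
  have hlogle : Real.log (m / (2 * r)) ≤ Real.log y := Real.log_le_log (by positivity) hy1
  have hyr : y * (2 * r) ≤ m * (1 + 1 / (2 * r - 1) + 3 * (r / m)) := by
    have e1 : m / s ≤ m / (2 * r - 1) := by
      have : 0 < 2 * r - 1 := by linarith
      gcongr
    have e2 : m * (1 + 1 / (2 * r - 1) + 3 * (r / m)) =
        (m / (2 * r - 1) + 3 / 2) * (2 * r) := by
      have : 2 * r - 1 ≠ 0 := by linarith
      field_simp
      ring
    rw [e2, hy]
    gcongr
  have hm3 : 0 ≤ m * (1 + 1 / (2 * r - 1) + 3 * (r / m)) :=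
    le_trans (by positivity) hyr
  rw [hlog]
  gcongr

end SRW3

/-- The limsup bound is stated with `ε`, avoiding the default value of a real `limsup` on unbounded
functions. Chains are indexed from 0, and only `z i` with `i < N` matter. -/
theorem lemma2p1 (r : ℝ → ℝ) (hr_top : Tendsto r atTop atTop)
    (hr_o : r =o[atTop] fun m : ℝ => m) :
    (∀ (b : ℝ), b < 2 / 3 → ∀ C : ℝ → Finset SRW3.Lattice,
      (∀ᶠ m in atTop, ∃ l : ℕ, 1 ≤ l ∧ (l : ℝ) ≤ r m ^ b ∧
        SRW3.cylinder m l (r m) ⊆ (C m : Set SRW3.Lattice) ∧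
        (C m : Set SRW3.Lattice) ⊆ SRW3.cylinder m 1 (r m)) →
      Tendsto (fun m : ℝ => SRW3.cap (C m) / (m * (Real.log (m / r m))⁻¹)) atTop
        (𝓝 (Real.pi / 3))) ∧
    (∀ C : ℝ → Finset SRW3.Lattice,
      (∀ᶠ m in atTop, ∃ (N : ℕ) (z : ℕ → SRW3.Lattice), (N : ℝ) ≤ m / r m ∧
        (∀ i, i + 1 < N → SRW3.euclNorm (z (i + 1) - z i) ≤ r m) ∧
        (C m : Set SRW3.Lattice) ⊆ ⋃ i < N, SRW3.ball (z i) (r m)) →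
      ∀ ε : ℝ, 0 < ε → ∀ᶠ m in atTop,
        SRW3.cap (C m) / (m * (Real.log (m / r m))⁻¹) ≤ Real.pi / 3 + ε) := by
  have hpi := Real.pi_pos
  have hmr := SRW3.tendsto_div_atTop_of_isLittleO hr_top hr_o
  have hlog : Tendsto (fun m => Real.log (m / r m)) atTop atTop :=
    Real.tendsto_log_atTop.comp hmr
  have hrm0 : Tendsto (fun m => r m / m) atTop (𝓝 0) := hr_o.tendsto_div_nhds_zero
  refine ⟨fun b hb C hC => ?_, fun C hC ε hε => ?_⟩
  · refine tendsto_order.2 ⟨fun a ha => ?_, fun a ha => ?_⟩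
    · have hcont : ContinuousAt (fun ε : ℝ => ((1 + ε) * (3 / Real.pi))⁻¹) 0 :=
        ContinuousAt.inv₀ (by fun_prop) (by positivity)
      have h1 : ∀ᶠ ε in 𝓝[>] (0 : ℝ), a < ((1 + ε) * (3 / Real.pi))⁻¹ :=
        (hcont.tendsto.mono_left nhdsWithin_le_nhds).eventually
          (lt_mem_nhds (by simpa using ha))
      obtain ⟨ε, haε, hε⟩ := (h1.and self_mem_nhdsWithin).exists
      have hε0 : (0 : ℝ) < ε := hε
      obtain ⟨K, D, hK0, hD0, hK⟩ := SRW3.exists_le_cap_of_cylinder_subset hε0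
      have hlim : Tendsto (fun m => (1 - r m / m) *
          ((1 + ε) * (3 / Real.pi) + D / Real.log (m / r m))⁻¹) atTop
          (𝓝 ((1 - 0) * ((1 + ε) * (3 / Real.pi) + 0)⁻¹)) :=
        (tendsto_const_nhds.sub hrm0).mul
          ((tendsto_const_nhds.add (tendsto_const_nhds.div_atTop hlog)).inv₀ (by positivity))
      rw [sub_zero, one_mul, add_zero] at hlim
      filter_upwards [hC, hlim.eventually (lt_mem_nhds haε), hr_top.eventually_ge_atTop K,
        hr_top.eventually_ge_atTop 1, hmr.eventually_ge_atTop 1,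
        hlog.eventually_gt_atTop 0, eventually_gt_atTop 0] with m hCm hlt hKm hr1 hmr1 hlogm hm0
      obtain ⟨l, hl1, hlb, hsub, -⟩ := hCm
      have hr0 : 0 < r m := by linarith
      have hl0 : (0 : ℝ) ≤ l := Nat.cast_nonneg l
      have hrm : r m ≤ m := (one_le_div hr0).1 hmr1
      have hl23 : (l : ℝ) ≤ r m ^ (2 / 3 : ℝ) :=
        hlb.trans (Real.rpow_le_rpow_of_exponent_le hr1 hb.le)
      have hl3 : (l : ℝ) ^ 3 ≤ r m ^ 2 := by
        calc (l : ℝ) ^ 3 ≤ (r m ^ (2 / 3 : ℝ)) ^ 3 := by gcongr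
          _ = r m ^ 2 := by
            rw [← Real.rpow_natCast, ← Real.rpow_mul hr0.le, ← Real.rpow_natCast]
            norm_num
      have hlr : (l : ℝ) ≤ r m := by
        refine hl23.trans ?_
        calc r m ^ (2 / 3 : ℝ) ≤ r m ^ (1 : ℝ) :=
              Real.rpow_le_rpow_of_exponent_le hr1 (by norm_num)
          _ = r m := Real.rpow_one _
      have hcap := hK m (r m) l (C m) hl1 hl3 hKm hrm hsub
      refine hlt.trans_le ?_
      rw [le_div_iff₀ (by positivity)]
      refine le_trans (le_of_eq ?_) (le_trans (div_le_div_of_nonneg_right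
        (sub_le_sub_left hlr m) (by positivity)) hcap)
      field_simp
    -- Half the gap suffices: the remaining corrections, including the shift by log 2 from doubling
    -- the radius, tend to factors 1.
    · set ε := (a - Real.pi / 3) / 2 with hε
      have hε0 : 0 < ε := by rw [hε]; linarith
      obtain ⟨K, hK1, hK⟩ := SRW3.exists_cap_le_of_subset_cylinder hε0
      have h2r : Tendsto (fun m => 1 / (2 * r m - 1)) atTop (𝓝 0) :=
        tendsto_const_nhds.div_atTop
          (tendsto_atTop_add_const_right _ (-1) (hr_top.const_mul_atTop two_pos))
      have hlim : Tendsto (fun m => (Real.pi / 3 + ε) * ((1 + 1 / (2 * r m - 1) + 3 * (r m / m)) *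
          (Real.log (m / r m) / (Real.log (m / r m) - Real.log 2)))) atTop
          (𝓝 ((Real.pi / 3 + ε) * ((1 + 0 + 3 * 0) * 1))) :=
        (((tendsto_const_nhds.add h2r).add (hrm0.const_mul 3)).mul
          (SRW3.tendsto_log_ratio.comp hlog)).const_mul _
      have hlt : (Real.pi / 3 + ε) * ((1 + 0 + 3 * 0) * 1) < a := by
        rw [hε]
        linarith
      filter_upwards [hC, hlim.eventually (gt_mem_nhds hlt), hr_top.eventually_ge_atTop K,
        hmr.eventually_ge_atTop (2 * K), hlog.eventually_gt_atTop 0,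
        eventually_gt_atTop 0] with m hCm hlt' hKm hmrK hlogm hm0
      obtain ⟨l, -, -, -, hsub⟩ := hCm
      have hcap := hK m (r m) (C m) hKm (by
        rw [mul_comm, ← div_div]
        linarith) hsub
      refine lt_of_le_of_lt ?_ hlt'
      rw [div_le_iff₀ (by positivity)]
      refine hcap.trans (le_of_eq ?_)
      field_simp
  · obtain ⟨K, hK1, hK⟩ := SRW3.cap_chain_le hε
    filter_upwards [hC, hr_top.eventually_ge_atTop K, hmr.eventually_ge_atTop K,
      hlog.eventually_gt_atTop 0, eventually_gt_atTop 0] with m hCm hrK hmrK hlogm hm0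
    obtain ⟨N, z, hN, hz, hsub⟩ := hCm
    have hr0 : 0 < r m := by linarith
    have hcap := hK (r m) (m / r m) hrK hmrK N z (C m) hN hz hsub
    rw [div_le_iff₀ (by positivity)]
    rwa [div_mul_cancel₀ _ hr0.ne', div_eq_mul_inv] at hcap
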